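/- **Setting.** For $X\in\mathbb R^{n\times d}$, $Y\in\mathbb R^n$ and $e\in\mathbb R^d$, ACRE (with the Refined Triangle Inequality, RTI, as backend) works as follows. For $G\in\mathbb R^{n\times n}$ let $C_{i,k}$ be the sum of the $k$ largest entries in row $i$ of $G$, and let $\mathrm{RTI}(G)_k$ be the square root of the sum of the $k$ largest among $C_{1,k},\dots,C_{n,k}$. Normalize the data by $\tilde X = X(X^\top X)^{-1/2}$, $\tilde e=(X^\top X)^{-1/2}e$. Let $R = Y - X(X^\top X)^{-1}X^\top Y$ be the least-squares residuals (unchanged by the normalization), $G=\tilde X\tilde X^\top$ and $Z=\tilde X\tilde e$. Let $A_k$ be the sum of the $k$ largest of the numbers $R_iZ_i$, $i\in[n]$, and $$B_k=\frac{\mathrm{RTI}(\mathrm{diag}(R)\,G\,\mathrm{diag}(R))_k\;\mathrm{RTI}(\mathrm{diag}(Z)\,G\,\mathrm{diag}(Z))_k}{1-\mathrm{RTI}\big((G_{ij}^2)_{ij}\big)_k},\qquad U_k=A_k+B_k,\quad L_k=A_k-B_k .$$ For $C,c,t_0>0$, a mean-zero probability distribution $\mathcal X$ on $\mathbb R^d$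 with finite second moments and invertible covariance $\Sigma=\mathbb E_{x\sim\mathcal X}[xx^\top]$ is called $(C,c,t_0)$-well-behaved if $$\Pr_{x\sim\mathcal X}\big[\,|\langle v,\Sigma^{-1/2}x\rangle|>t\,\big]\le \exp(-c\,t^{C})\qquad\text{for all unit vectors } v\in\mathbb R^d \text{ and all } t\ge t_0 .$$ **Theorem.** Let $C,c,t_0>0$. There are a function $k_{\mathrm{threshold}}(n,d)$ with $$k_{\mathrm{threshold}}(n,d)=\tilde\Theta\left(\min\left\{\frac{n}{\sqrt d},\frac{n^2}{d^2}\right\}\right),$$ constants $K>0$ and $a\in\mathbb N$, and a negligible function $\eta$ (that is, $n^m\eta(n)\to0$ as $n\to\infty$ for every $m\in\mathbb N$), all depending only on $(C,c,t_0)$, such that the following holds for all $n$ and $d$, every $(C,c,t_0)$-well-behaved distribution $\mathcal X$ on $\mathbb R^d$, every $\beta_{\mathrm{gt}}\in\mathbb R^d$ and every unit vector $e\in\mathbb R^d$. Let the rows of $X\in\mathbb R^{n\times d}$ be i.i.d. from $\mathcal X$ and, given $X$, let $Y\sim\mathcal N(X\beta_{\mathrm{gt}},I_n)$. Then, with probability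 at least $1-\eta(n)$, simultaneously for all integers $1\le k\le n$ with $k<k_{\mathrm{threshold}}(n,d)$, the bounds of ACRE satisfy $L_k>0$ and $$1\;\le\;\frac{U_k}{L_k}\;\le\;1+K(\log n)^{a}\cdot\frac{d+k\sqrt d}{n}.$$ Here $f(n,d)=\tilde\Theta(g(n,d))$ means that there are $K'>0$ and $b\in\mathbb N$ with $g/(K'(\log n)^{b})\le f\le K'(\log n)^{b}g$ for all $n\ge2$ and $d\ge1$. -/

import Mathlib

open scoped MatrixOrder Matrix
open MeasureTheory ProbabilityTheory Filter Topology

noncomputable section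

namespace RobustOLS

/-! ### The algorithm -/

/-- The entries of `v`, sorted in decreasing order. -/
def sortDesc {n : ℕ} (v : Fin n → ℝ) : Fin n → ℝ :=
  fun i => v (Tuple.sort (fun j => -v j) i)

/-- Cumulative sum: the sum of the first `k` entries of `v`. -/
def cumSum {n : ℕ} (v : Fin n → ℝ) (k : ℕ) : ℝ :=
  ∑ i : Fin n, if (i : ℕ) < k then v i else 0

/-- Refined Triangle Inequality: sort every row of the Gram matrix `G` decreasingly and take
cumulative sums along the rows, sort every column of the result decreasingly and take cumulative
sums along the columns; the `k`-th output is the square root of the `(k, k)` entry. -/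
def rti {n : ℕ} (G : Matrix (Fin n) (Fin n) ℝ) (k : ℕ) : ℝ :=
  √(cumSum (sortDesc (fun i => cumSum (sortDesc (G i)) k)) k)

/-- Unnormalized empirical second moment `Xᵀ X`. -/
def empSecondMoment {n d : ℕ} (X : Matrix (Fin n) (Fin d) ℝ) : Matrix (Fin d) (Fin d) ℝ :=
  Xᵀ * X

/-- The ordinary least squares fit `(Xᵀ X)⁻¹ Xᵀ Y`. -/
def olsFit {n d : ℕ} (X : Matrix (Fin n) (Fin d) ℝ) (Y : Fin n → ℝ) : Fin d → ℝ :=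
  (empSecondMoment X)⁻¹ *ᵥ (Xᵀ *ᵥ Y)

/-- The residuals of the ordinary least squares fit. -/
def residual {n d : ℕ} (X : Matrix (Fin n) (Fin d) ℝ) (Y : Fin n → ℝ) : Fin n → ℝ :=
  Y - X *ᵥ olsFit X Y

/-- First-order term of ACRE, for normalized data: cumulative sums of the decreasingly sorted
influence scores `R i * Z i`, where `Z = X e`. -/
def acreFirstOrder {n d : ℕ} (X : Matrix (Fin n) (Fin d) ℝ) (Y : Fin n → ℝ) (e : Fin d → ℝ)
    (k : ℕ) : ℝ :=
  cumSum (sortDesc (fun i => residual X Y i * (X *ᵥ e) i)) k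

/-- Error term of ACRE, for normalized data: `M_{X⊗X}`, `M_{XR}`, `M_{XZ}` are the RTI bounds for
the entrywise square of `G = X Xᵀ`, for `diag(R) G diag(R)` and for `diag(Z) G diag(Z)`. -/
def acreErrorTerm {n d : ℕ} (X : Matrix (Fin n) (Fin d) ℝ) (Y : Fin n → ℝ) (e : Fin d → ℝ)
    (k : ℕ) : ℝ :=
  let G : Matrix (Fin n) (Fin n) ℝ := X * Xᵀ
  let R : Fin n → ℝ := residual X Y
  let Z : Fin n → ℝ := X *ᵥ e
  1 / (1 - rti (G.map (fun g => g ^ 2)) k)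
    * rti (Matrix.diagonal R * G * Matrix.diagonal R) k
    * rti (Matrix.diagonal Z * G * Matrix.diagonal Z) k

/-- `(Xᵀ X)^{-1/2}`. -/
def normalizer {n d : ℕ} (X : Matrix (Fin n) (Fin d) ℝ) : Matrix (Fin d) (Fin d) ℝ :=
  (CFC.sqrt (empSecondMoment X))⁻¹

/-- The upper bound `U_k` of ACRE. The data are first normalized to have identity second moment:
`X` is replaced by `X (XᵀX)^{-1/2}` and `e` by `(XᵀX)^{-1/2} e`, which leaves the quantities
`⟨β - β_S, e⟩` unchanged. -/
def acreUpper {n d : ℕ} (X : Matrix (Fin n) (Fin d) ℝ) (Y : Fin n → ℝ) (e : Fin d → ℝ)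
    (k : ℕ) : ℝ :=
  acreFirstOrder (X * normalizer X) Y (normalizer X *ᵥ e) k
    + acreErrorTerm (X * normalizer X) Y (normalizer X *ᵥ e) k

/-- The lower bound `L_k` of ACRE, with the same normalization. -/
def acreLower {n d : ℕ} (X : Matrix (Fin n) (Fin d) ℝ) (Y : Fin n → ℝ) (e : Fin d → ℝ)
    (k : ℕ) : ℝ :=
  acreFirstOrder (X * normalizer X) Y (normalizer X *ᵥ e) k
    - acreErrorTerm (X * normalizer X) Y (normalizer X *ᵥ e) k

/-! ### The distributional assumptions -/

/-- The second moment matrix `E[X Xᵀ]` of a distribution on `ℝ^d`. -/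
def secondMoment {d : ℕ} (μ : Measure (Fin d → ℝ)) : Matrix (Fin d) (Fin d) ℝ :=
  Matrix.of fun i j => ∫ x, x i * x j ∂μ

/-- Well-behaved distributions with explicit constants: mean zero, invertible covariance `Σ`, and
`P(|⟨v, Σ^{-1/2} X⟩| > t) ≤ exp(-c t^C)` for all unit vectors `v` and all `t ≥ t₀`. -/
structure WellBehaved {d : ℕ} (C c t₀ : ℝ) (μ : Measure (Fin d → ℝ)) : Prop where
  isProbability : IsProbabilityMeasure μ
  memLp_two : ∀ j, MemLp (fun x : Fin d → ℝ => x j) 2 μ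
  mean_zero : ∀ j, ∫ x, x j ∂μ = 0
  posDef : (secondMoment μ).PosDef
  tail : ∀ v : Fin d → ℝ, v ⬝ᵥ v = 1 → ∀ t : ℝ, t₀ ≤ t →
    μ {x | t < |v ⬝ᵥ ((CFC.sqrt (secondMoment μ))⁻¹ *ᵥ x)|} ≤ ENNReal.ofReal (Real.exp (-(c * t ^ C)))

/-- The joint law of the covariates `X` (rows i.i.d. from `μ`) and of the noise `ζ`, a standard
Gaussian vector in `ℝ^n` independent of `X`. -/
def designNoiseLaw {d : ℕ} (μ : Measure (Fin d → ℝ)) (n : ℕ) :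
    Measure ((Fin n → Fin d → ℝ) × (Fin n → ℝ)) :=
  (Measure.pi fun _ : Fin n => μ).prod (Measure.pi fun _ : Fin n => gaussianReal 0 1)

/-! ### Asymptotic notions -/

/-- `η` is negligible: it decays faster than every inverse polynomial. -/
def Negligible (η : ℕ → ℝ) : Prop :=
  ∀ m : ℕ, Tendsto (fun n : ℕ => (n : ℝ) ^ m * η n) atTop (𝓝 0)

/-- `f = Θ̃(g)`: equality up to a constant and a power of `log n`, uniformly in `d`. -/
def IsThetaTilde (f g : ℕ → ℕ → ℝ) : Prop :=
  ∃ K : ℝ, 0 < K ∧ ∃ a : ℕ, ∀ n d : ℕ, 2 ≤ n → 1 ≤ d →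
    g n d / (K * Real.log n ^ a) ≤ f n d ∧ f n d ≤ K * Real.log n ^ a * g n d

end RobustOLS

end

namespace RobustOLS

/-! ### Sums of the largest entries -/

/-! After normalization ACRE sees only the hat matrix `G`, the influence vector `Z = X (XᵀX)⁻¹ e`
and the residual `R = ζ - G ζ`. Suppose that, up to powers of `log n`, `G` has diagonal at most `d /
n` and off-diagonal entries at most `√d / n`, that `|R i|` is at most constant, and that with `s =
‖e‖ / n` one has `|Z i| ≤ s` everywhere and `R i * Z i ≥ s` for at least `k` indices. A row of `G`
contains only one diagonal entry, so RTI gives `B ≲ k s (d + k √d) / n`, while `A ≳ k s`; the ratio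
is the claimed error (`ratio_bound`, `acre_on_good_event`). The denominator stays above `1/2` when
`k d² ≪ n²` and `k² d ≪ n²`, which is the threshold.

The entries of `G` and `Z` are controlled by leaving one row out. By Sherman-Morrison
(`abs_dotProduct_inv_add_le`), putting row `i` back only shrinks `⟨x i, A⁻¹ v⟩`, where `A` is the
second moment of the other rows. Since `x i` is independent of `A`, the tail assumption applies to
it conditionally (`pi_tail_of_invariant`). What remains is `A ≥ n / l`: a fourth-moment argument
bounds every marginal away from zero with constant probability (`exists_small_ball`), and a Chernoff
bound with a grid makes this uniform in the direction (`coercive_of_grid`, `pi_grid_le`). Only this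
lower bound is needed, not concentration of `XᵀX`.

For `A_k`, Cauchy-Schwarz bounds `‖Z‖` from below, so with the pointwise upper bound many `|Z i|`
are of order `s` (`le_card_large`). The independent Gaussian signs make a constant fraction of the
products `Z i * ζ i` large (`goodNoise`), and `G ζ` is a small perturbation. General covariances
reduce to the isotropic case because `G` and `Z` are invariant under a linear change of the
covariates. -/

theorem sortDesc_antitone {n : ℕ} (v : Fin n → ℝ) : Antitone (sortDesc v) := by
  intro i j h
  have := Tuple.monotone_sort (fun j => -v j) h
  simpa [sortDesc] using this

theorem cumSum_sortDesc_eq {n : ℕ} (v : Fin n → ℝ) (k : ℕ) :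
    ∃ T : Finset (Fin n), T.card ≤ k ∧ cumSum (sortDesc v) k = ∑ i ∈ T, v i := by
  refine ⟨(Finset.univ.filter fun i : Fin n => (i : ℕ) < k).map
    (Tuple.sort (fun j => -v j)).toEmbedding, ?_, ?_⟩
  · rw [Finset.card_map, ← Finset.card_range k,
      ← Finset.card_map (f := Fin.valEmbedding) (s := Finset.univ.filter _)]
    refine Finset.card_le_card fun x hx => ?_
    simp only [Finset.mem_map, Finset.mem_filter] at hx
    obtain ⟨y, hy, rfl⟩ := hx
    simpa using hy.2
  · simp [cumSum, sortDesc, Finset.sum_filter]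

theorem cumSum_sortDesc_le {n : ℕ} {v : Fin n → ℝ} {b : ℝ} (hb : 0 ≤ b) (h : ∀ i, v i ≤ b)
    (k : ℕ) : cumSum (sortDesc v) k ≤ k * b := by
  obtain ⟨T, hT, hv⟩ := cumSum_sortDesc_eq v k
  rw [hv]
  calc ∑ i ∈ T, v i ≤ T.card • b := Finset.sum_le_card_nsmul _ _ _ fun i _ => h i
    _ ≤ k * b := by rw [nsmul_eq_mul]; gcongr

/-- A selection of entries of one Gram row uses the diagonal entry at most once. This yields `D + k
O` instead of `k D`, and is where RTI gains. -/
theorem cumSum_sortDesc_le_add {n : ℕ} {v : Fin n → ℝ} {D O : ℝ} (i : Fin n) (hD : 0 ≤ D)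
    (hO : 0 ≤ O) (hi : v i ≤ D) (h : ∀ j, j ≠ i → v j ≤ O) (k : ℕ) :
    cumSum (sortDesc v) k ≤ D + k * O := by
  obtain ⟨T, hT, hv⟩ := cumSum_sortDesc_eq v k
  rw [hv]
  calc ∑ j ∈ T, v j ≤ ∑ j ∈ T, ((if j = i then D else 0) + O) := by
        refine Finset.sum_le_sum fun j _ => ?_
        split_ifs with hj
        · subst hj; linarith
        · linarith [h j hj]
    _ = (if i ∈ T then D else 0) + T.card * O := by
        rw [Finset.sum_add_distrib, Finset.sum_ite_eq', Finset.sum_const, nsmul_eq_mul]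
    _ ≤ D + k * O := by
        gcongr
        split_ifs <;> linarith

/-- If the sorted entry at a position `i < k` were below `a`, all entries that are at least `a`
would sit strictly before `i`, so there would be fewer than `k` of them. -/
theorem le_cumSum_sortDesc {n : ℕ} {v : Fin n → ℝ} {a : ℝ} {k : ℕ}
    (h : k ≤ (Finset.univ.filter fun i => a ≤ v i).card) :
    k * a ≤ cumSum (sortDesc v) k := by
  classical
  have hkn : k ≤ n := h.trans ((Finset.card_le_univ _).trans_eq (Fintype.card_fin n))
  have key : ∀ i : Fin n, (i : ℕ) < k → a ≤ sortDesc v i := by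
    intro i hi
    by_contra! hlt
    have hsub : (Finset.univ.filter fun i => a ≤ v i) ⊆
        (Finset.Iio i).map (Tuple.sort (fun j => -v j)).toEmbedding := by
      intro j hj
      simp only [Finset.mem_filter, Finset.mem_univ, true_and] at hj
      rw [Finset.mem_map]
      refine ⟨(Tuple.sort (fun j => -v j)).symm j, ?_, by simp⟩
      rw [Finset.mem_Iio]
      by_contra! hle
      have := sortDesc_antitone v hle
      simp only [sortDesc, Equiv.apply_symm_apply] at this hlt
      linarith
    have := Finset.card_le_card hsub
    rw [Finset.card_map, Fin.card_Iio] at this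
    omega
  have hcard : (Finset.univ.filter fun i : Fin n => (i : ℕ) < k).card = k := by
    rw [← Finset.card_map Fin.valEmbedding]
    conv_rhs => rw [← Finset.card_range k]
    congr 1
    ext x
    simp only [Finset.mem_map, Finset.mem_filter, Finset.mem_univ, true_and, Finset.mem_range]
    exact ⟨by rintro ⟨y, hy, rfl⟩; exact hy, fun hx => ⟨⟨x, by omega⟩, hx, rfl⟩⟩
  rw [cumSum, ← Finset.sum_filter]
  calc (k : ℝ) * a = (Finset.univ.filter fun i : Fin n => (i : ℕ) < k).card • a := by
        rw [hcard, nsmul_eq_mul]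
    _ ≤ _ := Finset.card_nsmul_le_sum _ _ _ fun i hi => key i (Finset.mem_filter.1 hi).2

theorem rti_le {n : ℕ} {G : Matrix (Fin n) (Fin n) ℝ} {D O : ℝ} (hD : 0 ≤ D) (hO : 0 ≤ O)
    (hd : ∀ i, G i i ≤ D) (ho : ∀ i j, j ≠ i → G i j ≤ O) (k : ℕ) :
    rti G k ≤ √(k * (D + k * O)) :=
  Real.sqrt_le_sqrt <| cumSum_sortDesc_le (by positivity)
    (fun i => cumSum_sortDesc_le_add i hD hO (hd i) (ho i) k) k

theorem rti_nonneg {n : ℕ} (G : Matrix (Fin n) (Fin n) ℝ) (k : ℕ) : 0 ≤ rti G k :=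
  Real.sqrt_nonneg _

theorem rti_diagonal_le {n : ℕ} {G : Matrix (Fin n) (Fin n) ℝ} {R : Fin n → ℝ} {D O r : ℝ}
    (hD : 0 ≤ D) (hO : 0 ≤ O) (hr : 0 ≤ r) (hd : ∀ i, |G i i| ≤ D)
    (ho : ∀ i j, j ≠ i → |G i j| ≤ O) (hR : ∀ i, |R i| ≤ r) (k : ℕ) :
    rti (Matrix.diagonal R * G * Matrix.diagonal R) k ≤ r * √(k * (D + k * O)) := by
  have key : ∀ i j b, |G i j| ≤ b →
      (Matrix.diagonal R * G * Matrix.diagonal R) i j ≤ r ^ 2 * b := by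
    intro i j b hb
    rw [Matrix.mul_diagonal, Matrix.diagonal_mul]
    calc R i * G i j * R j ≤ |R i * G i j * R j| := le_abs_self _
      _ = |R i| * |R j| * |G i j| := by rw [abs_mul, abs_mul]; ring
      _ ≤ r * r * b := by
        have := hR i
        have := hR j
        gcongr
      _ = r ^ 2 * b := by ring
  refine (rti_le (D := r ^ 2 * D) (O := r ^ 2 * O) (by positivity) (by positivity)
    (fun i => key _ _ _ (hd i)) (fun i j h => key _ _ _ (ho i j h)) k).trans_eq ?_
  rw [show (k : ℝ) * (r ^ 2 * D + k * (r ^ 2 * O)) = r ^ 2 * (k * (D + k * O)) by ring,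
    Real.sqrt_mul (by positivity), Real.sqrt_sq hr]

/-- The factor 4 arises from `(A + B) / (A - B) = 1 + 2 B / (A - B)` and `A - B ≥ A / 2`. -/
theorem div_bounds {A B a ρ : ℝ} (ha : 0 < a) (hA : a ≤ A) (hB0 : 0 ≤ B) (hB : B ≤ ρ * a)
    (hρ : ρ ≤ 1 / 2) : 0 < A - B ∧ 1 ≤ (A + B) / (A - B) ∧ (A + B) / (A - B) ≤ 1 + 4 * ρ := by
  have hρ0 : 0 ≤ ρ := by
    by_contra! h
    linarith [mul_neg_of_neg_of_pos h ha]
  have hBA : B ≤ ρ * A := hB.trans (by gcongr)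
  have hL : A / 2 ≤ A - B := by nlinarith
  have hL0 : 0 < A - B := by linarith
  refine ⟨hL0, ?_, ?_⟩
  · rw [le_div_iff₀ hL0]; linarith
  · rw [div_le_iff₀ hL0]; nlinarith

/-- The first-order term is at least `k * a`, and the error term is smaller by a factor
`2 r z (D + k O) / a`, so the ratio of the two ACRE bounds is close to one. -/
theorem ratio_bound {n : ℕ} {G : Matrix (Fin n) (Fin n) ℝ} {R Z : Fin n → ℝ} {D O r z a ρ : ℝ}
    {k : ℕ} (hk : 1 ≤ k) (hD : 0 ≤ D) (hO : 0 ≤ O) (hr : 0 ≤ r) (hz : 0 ≤ z) (ha : 0 < a)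
    (hd : ∀ i, |G i i| ≤ D) (ho : ∀ i j, j ≠ i → |G i j| ≤ O)
    (hR : ∀ i, |R i| ≤ r) (hZ : ∀ i, |Z i| ≤ z)
    (hcount : k ≤ (Finset.univ.filter fun i => a ≤ R i * Z i).card)
    (hG : k * (D ^ 2 + k * O ^ 2) ≤ 1 / 4) (hρ : 2 * r * z * (D + k * O) ≤ ρ * a)
    (hρ' : ρ ≤ 1 / 2) :
    let A := cumSum (sortDesc fun i => R i * Z i) k
    let B := 1 / (1 - rti (G.map (fun g => g ^ 2)) k)
      * rti (Matrix.diagonal R * G * Matrix.diagonal R) k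
      * rti (Matrix.diagonal Z * G * Matrix.diagonal Z) k
    0 < A - B ∧ 1 ≤ (A + B) / (A - B) ∧ (A + B) / (A - B) ≤ 1 + 4 * ρ := by
  have hk0 : (1 : ℝ) ≤ k := by exact_mod_cast hk
  have hA := le_cumSum_sortDesc hcount
  have hG1 : rti (G.map (fun g => g ^ 2)) k ≤ 1 / 2 := by
    refine (rti_le (D := D ^ 2) (O := O ^ 2) (by positivity) (by positivity) (fun i => ?_)
      (fun i j h => ?_) k).trans ?_
    · rw [Matrix.map_apply, ← sq_abs]
      exact pow_le_pow_left₀ (abs_nonneg _) (hd i) 2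
    · rw [Matrix.map_apply, ← sq_abs]
      exact pow_le_pow_left₀ (abs_nonneg _) (ho i j h) 2
    · refine Real.sqrt_le_iff.2 ⟨by norm_num, hG.trans (by norm_num)⟩
  have h1 := rti_diagonal_le hD hO hr hd ho hR k
  have h2 := rti_diagonal_le hD hO hz hd ho hZ k
  have h1' := rti_nonneg (Matrix.diagonal R * G * Matrix.diagonal R) k
  have h2' := rti_nonneg (Matrix.diagonal Z * G * Matrix.diagonal Z) k
  have hinv : 1 / (1 - rti (G.map (fun g => g ^ 2)) k) ≤ 2 := by
    rw [div_le_iff₀ (by linarith)]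
    linarith
  have hinv0 : 0 ≤ 1 / (1 - rti (G.map (fun g => g ^ 2)) k) :=
    div_nonneg zero_le_one (by linarith)
  generalize 1 / (1 - rti (G.map (fun g => g ^ 2)) k) = x at *
  generalize rti (Matrix.diagonal R * G * Matrix.diagonal R) k = y at *
  generalize rti (Matrix.diagonal Z * G * Matrix.diagonal Z) k = w at *
  refine div_bounds (a := k * a) (by positivity) hA (by positivity) ?_ hρ'
  calc x * y * w ≤ 2 * (r * √(k * (D + k * O))) * (z * √(k * (D + k * O))) := by gcongr
    _ = k * (2 * r * z * (D + k * O)) := by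
        have := Real.mul_self_sqrt (show 0 ≤ k * (D + k * O) by positivity)
        linear_combination 2 * r * z * this
    _ ≤ k * (ρ * a) := by gcongr
    _ = ρ * (k * a) := by ring

/-! ### The least-squares fit -/

/-- The hat matrix `X (XᵀX)⁻¹ Xᵀ`. -/
noncomputable def hat {n d : ℕ} (X : Matrix (Fin n) (Fin d) ℝ) : Matrix (Fin n) (Fin n) ℝ :=
  X * (Xᵀ * X)⁻¹ * Xᵀ

/-- The vector `X (XᵀX)⁻¹ e`. -/
noncomputable def infl {n d : ℕ} (X : Matrix (Fin n) (Fin d) ℝ) (e : Fin d → ℝ) : Fin n → ℝ :=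
  X *ᵥ ((Xᵀ * X)⁻¹ *ᵥ e)

theorem inv_gram_mul {n d : ℕ} (X : Matrix (Fin n) (Fin d) ℝ) (S : Matrix (Fin d) (Fin d) ℝ) :
    ((X * S)ᵀ * (X * S))⁻¹ = S⁻¹ * (Xᵀ * X)⁻¹ * Sᵀ⁻¹ := by
  rw [show (X * S)ᵀ * (X * S) = Sᵀ * (Xᵀ * X) * S by
    simp only [Matrix.transpose_mul, Matrix.mul_assoc], Matrix.mul_inv_rev, Matrix.mul_inv_rev,
    Matrix.mul_assoc]

/-- A change of basis of the covariates keeps the column space. This serves twice: for the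
normalization inside ACRE and for whitening the distribution. -/
theorem hat_mul_right {n d : ℕ} (X : Matrix (Fin n) (Fin d) ℝ) {S : Matrix (Fin d) (Fin d) ℝ}
    (hS : IsUnit S.det) : hat (X * S) = hat X := by
  have hS' : IsUnit Sᵀ.det := by rwa [Matrix.det_transpose]
  rw [hat, inv_gram_mul]
  simp only [hat, Matrix.transpose_mul, Matrix.mul_assoc]
  rw [Matrix.nonsing_inv_mul_cancel_left _ _ hS', Matrix.mul_nonsing_inv_cancel_left _ _ hS]

theorem infl_mul_right {n d : ℕ} (X : Matrix (Fin n) (Fin d) ℝ) {S : Matrix (Fin d) (Fin d) ℝ}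
    (hS : IsUnit S.det) (e : Fin d → ℝ) : infl (X * S) (Sᵀ *ᵥ e) = infl X e := by
  have hS' : IsUnit Sᵀ.det := by rwa [Matrix.det_transpose]
  rw [infl, inv_gram_mul]
  simp only [infl, Matrix.mul_assoc, Matrix.mulVec_mulVec]
  rw [Matrix.nonsing_inv_mul _ hS', Matrix.mul_nonsing_inv_cancel_left _ _ hS, Matrix.mul_one]

section Sqrt

variable {d : ℕ} {M : Matrix (Fin d) (Fin d) ℝ}

theorem isUnit_det_sqrt (hM : M.PosDef) : IsUnit (CFC.sqrt M).det := by
  have h := CFC.sqrt_mul_sqrt_self M (Matrix.nonneg_iff_posSemidef.2 hM.posSemidef)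
  have h2 : IsUnit M.det := hM.det_pos.ne'.isUnit
  rw [← h, Matrix.det_mul] at h2
  exact isUnit_of_mul_isUnit_left h2

theorem transpose_sqrt (M : Matrix (Fin d) (Fin d) ℝ) : (CFC.sqrt M)ᵀ = CFC.sqrt M := by
  have h := (Matrix.nonneg_iff_posSemidef.1 (CFC.sqrt_nonneg M)).isHermitian
  rwa [Matrix.IsHermitian, Matrix.conjTranspose_eq_transpose_of_trivial] at h

theorem inv_sqrt_mul_inv_sqrt (hM : M.PosDef) : (CFC.sqrt M)⁻¹ * (CFC.sqrt M)⁻¹ = M⁻¹ := by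
  rw [← Matrix.mul_inv_rev,
    CFC.sqrt_mul_sqrt_self M (Matrix.nonneg_iff_posSemidef.2 hM.posSemidef)]

theorem inv_sqrt_mul_mul_inv_sqrt (hM : M.PosDef) :
    (CFC.sqrt M)⁻¹ * M * (CFC.sqrt M)⁻¹ = 1 := by
  have h := CFC.sqrt_mul_sqrt_self M (Matrix.nonneg_iff_posSemidef.2 hM.posSemidef)
  have hu := isUnit_det_sqrt hM
  nth_rw 2 [← h]
  rw [Matrix.nonsing_inv_mul_cancel_left _ _ hu, Matrix.mul_nonsing_inv _ hu]

end Sqrt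

/-! ### The quantities ACRE computes, after normalization. -/

theorem residual_eq {n d : ℕ} (X : Matrix (Fin n) (Fin d) ℝ) (Y : Fin n → ℝ) :
    residual X Y = Y - hat X *ᵥ Y := by
  simp [residual, olsFit, hat, empSecondMoment, Matrix.mulVec_mulVec, Matrix.mul_assoc]

theorem hat_mul_self {n d : ℕ} {X : Matrix (Fin n) (Fin d) ℝ} (hX : (Xᵀ * X).PosDef) :
    hat X * X = X := by
  rw [hat, Matrix.mul_assoc, Matrix.mul_assoc, Matrix.nonsing_inv_mul _ hX.det_pos.ne'.isUnit,
    Matrix.mul_one]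

theorem normalized_mul_transpose {n d : ℕ} {X : Matrix (Fin n) (Fin d) ℝ}
    (hX : (Xᵀ * X).PosDef) : X * normalizer X * (X * normalizer X)ᵀ = hat X := by
  rw [Matrix.transpose_mul, normalizer, Matrix.transpose_nonsing_inv, transpose_sqrt, hat,
    empSecondMoment, ← inv_sqrt_mul_inv_sqrt hX]
  simp only [Matrix.mul_assoc]

theorem normalized_mulVec {n d : ℕ} {X : Matrix (Fin n) (Fin d) ℝ} (hX : (Xᵀ * X).PosDef)
    (e : Fin d → ℝ) : (X * normalizer X) *ᵥ (normalizer X *ᵥ e) = infl X e := by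
  rw [infl, ← inv_sqrt_mul_inv_sqrt hX]
  simp only [normalizer, empSecondMoment, Matrix.mulVec_mulVec, Matrix.mul_assoc]

theorem normalized_residual {n d : ℕ} {X : Matrix (Fin n) (Fin d) ℝ} (hX : (Xᵀ * X).PosDef)
    (β : Fin d → ℝ) (ζ : Fin n → ℝ) :
    residual (X * normalizer X) (X *ᵥ β + ζ) = ζ - hat X *ᵥ ζ := by
  have hN : IsUnit (normalizer X).det := by
    have h := isUnit_det_sqrt hX
    exact Matrix.isUnit_nonsing_inv_det _ h
  rw [residual_eq, hat_mul_right X hN, Matrix.mulVec_add, Matrix.mulVec_mulVec,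
    hat_mul_self hX]
  abel

/-! ### Leave-one-out estimates -/

theorem dotProduct_self_nonneg' {ι : Type*} [Fintype ι] (v : ι → ℝ) : 0 ≤ v ⬝ᵥ v :=
  Finset.sum_nonneg fun i _ => mul_self_nonneg (v i)

theorem dotProduct_sq_le {ι : Type*} [Fintype ι] (u v : ι → ℝ) :
    (u ⬝ᵥ v) ^ 2 ≤ (u ⬝ᵥ u) * (v ⬝ᵥ v) := by
  simpa only [dotProduct, sq] using Finset.sum_mul_sq_le_sq_mul_sq Finset.univ u v

theorem dotProduct_self_le {d : ℕ} {w : Fin d → ℝ} {t : ℝ} (h : ∀ j, |w j| ≤ t) :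
    w ⬝ᵥ w ≤ d * t ^ 2 := by
  calc w ⬝ᵥ w ≤ ∑ _j : Fin d, t ^ 2 := Finset.sum_le_sum fun j _ => by
        rw [← sq, ← sq_abs]
        exact pow_le_pow_left₀ (abs_nonneg _) (h j) 2
    _ = d * t ^ 2 := by simp

/-- The second moment of all rows but the `i`-th. -/
noncomputable def loo {n d : ℕ} (x : Fin n → Fin d → ℝ) (i : Fin n) : Matrix (Fin d) (Fin d) ℝ :=
  ∑ j ∈ Finset.univ.erase i, Matrix.vecMulVec (x j) (x j)

/-! ### Inverses of coercive matrices. -/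

section Coercive

variable {d : ℕ} {A : Matrix (Fin d) (Fin d) ℝ} {κ : ℝ}

theorem posDef_of_coercive (hA : Aᵀ = A) (hκ : 0 < κ) (h : ∀ v, κ * (v ⬝ᵥ v) ≤ v ⬝ᵥ A *ᵥ v) :
    A.PosDef := by
  refine Matrix.PosDef.of_dotProduct_mulVec_pos
    (by rw [Matrix.IsHermitian, Matrix.conjTranspose_eq_transpose_of_trivial, hA]) fun v hv => ?_
  rw [star_trivial]
  refine lt_of_lt_of_le (mul_pos hκ ?_) (h v)
  exact lt_of_le_of_ne (dotProduct_self_nonneg' v)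
    (fun h0 => hv (dotProduct_self_eq_zero.1 h0.symm))

theorem mulVec_inv_mulVec (hA : A.PosDef) (u : Fin d → ℝ) : A *ᵥ (A⁻¹ *ᵥ u) = u := by
  rw [Matrix.mulVec_mulVec, Matrix.mul_nonsing_inv _ hA.det_pos.ne'.isUnit, Matrix.one_mulVec]

theorem inv_mulVec_mulVec (hA : A.PosDef) (u : Fin d → ℝ) : A⁻¹ *ᵥ (A *ᵥ u) = u := by
  rw [Matrix.mulVec_mulVec, Matrix.nonsing_inv_mul _ hA.det_pos.ne'.isUnit, Matrix.one_mulVec]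

theorem dotProduct_inv_mulVec_comm (hA : Aᵀ = A) (u v : Fin d → ℝ) :
    u ⬝ᵥ A⁻¹ *ᵥ v = v ⬝ᵥ A⁻¹ *ᵥ u := by
  rw [Matrix.dotProduct_mulVec, ← Matrix.mulVec_transpose, Matrix.transpose_nonsing_inv, hA,
    dotProduct_comm]

theorem coercive_inv (hA : Aᵀ = A) (hκ : 0 < κ) (h : ∀ v, κ * (v ⬝ᵥ v) ≤ v ⬝ᵥ A *ᵥ v)
    (u : Fin d → ℝ) : κ * ((A⁻¹ *ᵥ u) ⬝ᵥ (A⁻¹ *ᵥ u)) ≤ u ⬝ᵥ A⁻¹ *ᵥ u := by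
  have := h (A⁻¹ *ᵥ u)
  rwa [mulVec_inv_mulVec (posDef_of_coercive hA hκ h), dotProduct_comm (A⁻¹ *ᵥ u) u] at this

/-- Coercivity and Cauchy-Schwarz give `κ ‖A⁻¹ u‖² ≤ ⟨u, A⁻¹ u⟩ ≤ ‖u‖ ‖A⁻¹ u‖`; one factor is
cancelled, the zero case being separate. -/
theorem norm_inv_mulVec_le (hA : Aᵀ = A) (hκ : 0 < κ)
    (h : ∀ v, κ * (v ⬝ᵥ v) ≤ v ⬝ᵥ A *ᵥ v) (u : Fin d → ℝ) :
    √((A⁻¹ *ᵥ u) ⬝ᵥ (A⁻¹ *ᵥ u)) ≤ √(u ⬝ᵥ u) / κ := by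
  have h1 := coercive_inv hA hκ h u
  have h2 := dotProduct_sq_le u (A⁻¹ *ᵥ u)
  have h3 := dotProduct_self_nonneg' (A⁻¹ *ᵥ u)
  have h4 := dotProduct_self_nonneg' u
  set a := (A⁻¹ *ᵥ u) ⬝ᵥ (A⁻¹ *ᵥ u)
  rw [le_div_iff₀ hκ]
  refine Real.le_sqrt_of_sq_le ?_
  rw [mul_pow, Real.sq_sqrt h3]
  rcases h3.eq_or_lt with h0 | h0
  · rw [← h0]; simpa using h4
  · refine le_of_mul_le_mul_right ?_ h0
    calc a * κ ^ 2 * a = (κ * a) ^ 2 := by ring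
      _ ≤ (u ⬝ᵥ A⁻¹ *ᵥ u) ^ 2 := pow_le_pow_left₀ (by positivity) h1 2
      _ ≤ _ := h2

theorem dotProduct_inv_mulVec_le (hA : Aᵀ = A) (hκ : 0 < κ)
    (h : ∀ v, κ * (v ⬝ᵥ v) ≤ v ⬝ᵥ A *ᵥ v) (u : Fin d → ℝ) :
    u ⬝ᵥ A⁻¹ *ᵥ u ≤ (u ⬝ᵥ u) / κ := by
  have h1 := coercive_inv hA hκ h u
  have h2 := dotProduct_sq_le u (A⁻¹ *ᵥ u)
  have h3 := dotProduct_self_nonneg' (A⁻¹ *ᵥ u)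
  have h4 := dotProduct_self_nonneg' u
  rw [le_div_iff₀ hκ]
  have h5 : 0 ≤ u ⬝ᵥ A⁻¹ *ᵥ u := le_trans (by positivity) h1
  rcases h5.eq_or_lt with h0 | h0
  · rw [← h0]; simpa using h4
  · refine le_of_mul_le_mul_right ?_ h0
    calc _ = κ * (u ⬝ᵥ A⁻¹ *ᵥ u) ^ 2 := by ring
      _ ≤ κ * ((u ⬝ᵥ u) * ((A⁻¹ *ᵥ u) ⬝ᵥ (A⁻¹ *ᵥ u))) := by gcongr
      _ = (u ⬝ᵥ u) * (κ * ((A⁻¹ *ᵥ u) ⬝ᵥ (A⁻¹ *ᵥ u))) := by ring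
      _ ≤ _ := by gcongr

/-- The Sherman-Morrison bound: adding a rank-one term along `w` shrinks `⟨w, A⁻¹ v⟩`. -/
theorem abs_dotProduct_inv_add_le (hA : Aᵀ = A) (hκ : 0 < κ)
    (h : ∀ v, κ * (v ⬝ᵥ v) ≤ v ⬝ᵥ A *ᵥ v) (w v : Fin d → ℝ) :
    |w ⬝ᵥ (A + Matrix.vecMulVec w w)⁻¹ *ᵥ v| ≤ |w ⬝ᵥ A⁻¹ *ᵥ v| := by
  set B := A + Matrix.vecMulVec w w with hBdef
  have hB : Bᵀ = B := by
    rw [hBdef, Matrix.transpose_add, hA]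
    congr 1
    ext i j
    simp [Matrix.vecMulVec_apply, mul_comm]
  have hrank : ∀ y, Matrix.vecMulVec w w *ᵥ y = (w ⬝ᵥ y) • w := by
    intro y
    ext i
    simp [Matrix.mulVec, Matrix.vecMulVec_apply, dotProduct, Finset.mul_sum, mul_comm,
      mul_left_comm]
  have hBc : ∀ y, κ * (y ⬝ᵥ y) ≤ y ⬝ᵥ B *ᵥ y := by
    intro y
    rw [hBdef, Matrix.add_mulVec, hrank, dotProduct_add, dotProduct_smul, dotProduct_comm y w,
      smul_eq_mul]
    nlinarith [h y, mul_self_nonneg (w ⬝ᵥ y)]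
  have hApd := posDef_of_coercive hA hκ h
  have hBpd := posDef_of_coercive hB hκ hBc
  have hnn : 0 ≤ w ⬝ᵥ A⁻¹ *ᵥ w := by
    refine le_trans ?_ (coercive_inv hA hκ h w)
    have := dotProduct_self_nonneg' (A⁻¹ *ᵥ w)
    positivity
  -- Applying `B` to `A⁻¹ w` gives a multiple of `w`; since the factor is at least 1, passing from
  -- `A⁻¹` to `B⁻¹` can only shrink.
  have key : A⁻¹ *ᵥ w = (1 + w ⬝ᵥ A⁻¹ *ᵥ w) • (B⁻¹ *ᵥ w) := by
    have : B *ᵥ (A⁻¹ *ᵥ w) = (1 + w ⬝ᵥ A⁻¹ *ᵥ w) • w := by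
      rw [hBdef, Matrix.add_mulVec, mulVec_inv_mulVec hApd, hrank, add_smul, one_smul]
    rw [← Matrix.mulVec_smul, ← this, inv_mulVec_mulVec hBpd]
  rw [dotProduct_inv_mulVec_comm hA, dotProduct_inv_mulVec_comm hB, key, dotProduct_smul,
    smul_eq_mul, abs_mul, abs_of_nonneg (by linarith : 0 ≤ 1 + w ⬝ᵥ A⁻¹ *ᵥ w)]
  exact le_mul_of_one_le_left (abs_nonneg _) (by linarith)

end Coercive

/-! ### Leverages and influences via the leave-one-out second moment. -/

section LeaveOneOut

variable {n d : ℕ} (x : Fin n → Fin d → ℝ)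

theorem gram_eq_sum : (Matrix.of x)ᵀ * Matrix.of x = ∑ j, Matrix.vecMulVec (x j) (x j) := by
  ext a b
  simp [Matrix.mul_apply, Matrix.sum_apply, Matrix.vecMulVec_apply]

theorem gram_eq_loo_add (i : Fin n) :
    (Matrix.of x)ᵀ * Matrix.of x = loo x i + Matrix.vecMulVec (x i) (x i) := by
  rw [gram_eq_sum, loo, Finset.sum_erase_add _ _ (Finset.mem_univ i)]

theorem transpose_loo (i : Fin n) : (loo x i)ᵀ = loo x i := by
  ext a b
  simp [loo, Matrix.sum_apply, Matrix.vecMulVec_apply, mul_comm]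

theorem dotProduct_loo_mulVec (i : Fin n) (v : Fin d → ℝ) :
    v ⬝ᵥ loo x i *ᵥ v = ∑ j ∈ Finset.univ.erase i, (x j ⬝ᵥ v) ^ 2 := by
  rw [loo, Matrix.sum_mulVec, dotProduct_sum]
  refine Finset.sum_congr rfl fun j _ => ?_
  rw [Matrix.vecMulVec_mulVec]
  simp [dotProduct_comm v (x j), sq]

theorem hat_apply (i j : Fin n) :
    hat (Matrix.of x) i j = x i ⬝ᵥ ((Matrix.of x)ᵀ * Matrix.of x)⁻¹ *ᵥ x j := by
  rw [hat, Matrix.mul_assoc, Matrix.mul_apply]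
  rfl

theorem infl_apply (e : Fin d → ℝ) (i : Fin n) :
    infl (Matrix.of x) e i = x i ⬝ᵥ ((Matrix.of x)ᵀ * Matrix.of x)⁻¹ *ᵥ e := rfl

/-- Each counted row contributes at least `‖v‖² / 64`, and omitting row `i` loses at most one of
them. -/
theorem coercive_loo {m : ℝ} {v : Fin d → ℝ}
    (h : m ≤ (Finset.univ.filter fun j => v ⬝ᵥ v ≤ 64 * (x j ⬝ᵥ v) ^ 2).card) (i : Fin n) :
    (m - 1) / 64 * (v ⬝ᵥ v) ≤ v ⬝ᵥ loo x i *ᵥ v := by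
  have hv := dotProduct_self_nonneg' v
  rw [dotProduct_loo_mulVec]
  set T := Finset.univ.filter fun j => v ⬝ᵥ v ≤ 64 * (x j ⬝ᵥ v) ^ 2 with hT
  have hc : (T.card : ℝ) - 1 ≤ (T.erase i).card := by
    have : T.card ≤ (T.erase i).card + 1 := by
      have := Finset.pred_card_le_card_erase (s := T) (a := i)
      omega
    have : (T.card : ℝ) ≤ (T.erase i).card + 1 := by exact_mod_cast this
    linarith
  calc (m - 1) / 64 * (v ⬝ᵥ v) ≤ (T.erase i).card * ((v ⬝ᵥ v) / 64) := by
        rw [div_mul_eq_mul_div, ← mul_div_assoc]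
        gcongr
        linarith
    _ = ∑ j ∈ T.erase i, (v ⬝ᵥ v) / 64 := by rw [Finset.sum_const, nsmul_eq_mul]
    _ ≤ ∑ j ∈ T.erase i, (x j ⬝ᵥ v) ^ 2 := by
        refine Finset.sum_le_sum fun j hj => ?_
        have := (Finset.mem_filter.1 (Finset.mem_of_mem_erase hj)).2
        linarith
    _ ≤ _ := Finset.sum_le_sum_of_subset_of_nonneg
        (Finset.erase_subset_erase _ (Finset.subset_univ _)) fun _ _ _ => sq_nonneg _

variable {x} {κ t : ℝ}

theorem transpose_gram : ((Matrix.of x)ᵀ * Matrix.of x)ᵀ = (Matrix.of x)ᵀ * Matrix.of x := by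
  rw [Matrix.transpose_mul, Matrix.transpose_transpose]

theorem coercive_gram (i : Fin n) (h : ∀ v, κ * (v ⬝ᵥ v) ≤ v ⬝ᵥ loo x i *ᵥ v)
    (v : Fin d → ℝ) : κ * (v ⬝ᵥ v) ≤ v ⬝ᵥ ((Matrix.of x)ᵀ * Matrix.of x) *ᵥ v := by
  rw [gram_eq_loo_add x i, Matrix.add_mulVec, dotProduct_add, Matrix.vecMulVec_mulVec]
  have := h v
  simp [dotProduct_comm v (x i)]
  nlinarith [mul_self_nonneg (x i ⬝ᵥ v)]

theorem abs_infl_le (hκ : 0 < κ) (ht : 0 ≤ t) (e : Fin d → ℝ) (i : Fin n)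
    (h : ∀ v, κ * (v ⬝ᵥ v) ≤ v ⬝ᵥ loo x i *ᵥ v)
    (he : |x i ⬝ᵥ (loo x i)⁻¹ *ᵥ e| ≤ t * √(((loo x i)⁻¹ *ᵥ e) ⬝ᵥ ((loo x i)⁻¹ *ᵥ e))) :
    |infl (Matrix.of x) e i| ≤ t * √(e ⬝ᵥ e) / κ := by
  rw [infl_apply, gram_eq_loo_add x i, mul_div_assoc]
  refine (abs_dotProduct_inv_add_le (transpose_loo x i) hκ h _ _).trans (he.trans ?_)
  gcongr
  exact norm_inv_mulVec_le (transpose_loo x i) hκ h e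

/-- Only `‖x j‖ ≤ √d t` enters, because `x i` acts as a generic direction on `A⁻¹ x j`; for `i = j`
this fails and `hat_diag_le` loses a full factor `d`. -/
theorem abs_hat_le (hκ : 0 < κ) (ht : 0 ≤ t) (i j : Fin n)
    (h : ∀ v, κ * (v ⬝ᵥ v) ≤ v ⬝ᵥ loo x i *ᵥ v) (hx : ∀ l, |x j l| ≤ t)
    (he : |x i ⬝ᵥ (loo x i)⁻¹ *ᵥ x j| ≤
      t * √(((loo x i)⁻¹ *ᵥ x j) ⬝ᵥ ((loo x i)⁻¹ *ᵥ x j))) :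
    |hat (Matrix.of x) i j| ≤ √d * t ^ 2 / κ := by
  rw [hat_apply, ← infl_apply]
  refine (abs_infl_le hκ ht _ i h he).trans ?_
  have : √(x j ⬝ᵥ x j) ≤ √d * t := by
    refine (Real.sqrt_le_sqrt (dotProduct_self_le hx)).trans_eq ?_
    rw [Real.sqrt_mul (by positivity), Real.sqrt_sq ht]
  calc t * √(x j ⬝ᵥ x j) / κ ≤ t * (√d * t) / κ := by gcongr
    _ = _ := by ring

theorem hat_diag_le (hκ : 0 < κ) (i : Fin n) (h : ∀ v, κ * (v ⬝ᵥ v) ≤ v ⬝ᵥ loo x i *ᵥ v)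
    (hx : ∀ j, |x i j| ≤ t) : hat (Matrix.of x) i i ≤ d * t ^ 2 / κ := by
  rw [hat_apply]
  refine (dotProduct_inv_mulVec_le transpose_gram hκ (coercive_gram i h) _).trans ?_
  have := dotProduct_self_le hx
  gcongr

theorem hat_transpose : (hat (Matrix.of x))ᵀ = hat (Matrix.of x) := by
  ext i j
  rw [Matrix.transpose_apply, hat_apply, hat_apply, dotProduct_inv_mulVec_comm transpose_gram]

/-- The hat matrix is a symmetric idempotent. The left side is the conditional variance of `(G ζ)
i`, so small leverage means small leakage of noise. -/
theorem sum_hat_sq (hX : ((Matrix.of x)ᵀ * Matrix.of x).PosDef) (i : Fin n) :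
    ∑ j, hat (Matrix.of x) i j ^ 2 = hat (Matrix.of x) i i := by
  have h : hat (Matrix.of x) * hat (Matrix.of x) = hat (Matrix.of x) := by
    nth_rw 2 [hat]
    rw [← Matrix.mul_assoc, ← Matrix.mul_assoc, hat_mul_self hX]
    rfl
  conv_rhs => rw [← h, Matrix.mul_apply]
  refine Finset.sum_congr rfl fun j _ => ?_
  rw [sq]
  congr 1
  exact congrFun (congrFun hat_transpose j) i

/-- Cauchy-Schwarz applied to `⟨X e, Z⟩ = ⟨e, e⟩`. -/
theorem dotProduct_self_le_infl (hX : ((Matrix.of x)ᵀ * Matrix.of x).PosDef) {e : Fin d → ℝ}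
    (he : ∀ i, |x i ⬝ᵥ e| ≤ t * √(e ⬝ᵥ e)) :
    e ⬝ᵥ e ≤ n * t ^ 2 * (infl (Matrix.of x) e ⬝ᵥ infl (Matrix.of x) e) := by
  have h0 := dotProduct_self_nonneg' e
  set Z := infl (Matrix.of x) e with hZ
  have h1 : (Matrix.of x *ᵥ e) ⬝ᵥ Z = e ⬝ᵥ e := by
    rw [hZ, infl, Matrix.dotProduct_mulVec, ← Matrix.mulVec_transpose, Matrix.mulVec_mulVec,
      dotProduct_inv_mulVec_comm transpose_gram, inv_mulVec_mulVec hX]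
  have h2 := dotProduct_sq_le (Matrix.of x *ᵥ e) Z
  have h3 : (Matrix.of x *ᵥ e) ⬝ᵥ (Matrix.of x *ᵥ e) ≤ n * (t * √(e ⬝ᵥ e)) ^ 2 :=
    dotProduct_self_le he
  rw [h1] at h2
  rw [mul_pow, Real.sq_sqrt h0] at h3
  have h4 := dotProduct_self_nonneg' Z
  rcases h0.eq_or_lt with h | h
  · rw [← h]; positivity
  · refine le_of_mul_le_mul_right ?_ h
    calc _ = (e ⬝ᵥ e) ^ 2 := by ring
      _ ≤ _ := h2
      _ ≤ n * (t ^ 2 * (e ⬝ᵥ e)) * (Z ⬝ᵥ Z) := by gcongr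
      _ = _ := by ring

end LeaveOneOut

/-! ### ACRE on a good event -/

/-- Entries below `s / (2 t)` carry at most a quarter of the guaranteed energy `n s² / t²`. The rest
must come from the large entries, each contributing at most `(t l s)²`. -/
theorem le_card_large {n : ℕ} {Z : Fin n → ℝ} {s t l : ℝ} (hs : 0 < s) (ht : 0 < t) (hl : 0 < l)
    (hZ : ∀ i, |Z i| ≤ t * l * s) (h : n * s ^ 2 ≤ t ^ 2 * (Z ⬝ᵥ Z)) :
    n / (2 * t ^ 4 * l ^ 2) ≤ ((Finset.univ.filter fun i => s / (2 * t) ≤ |Z i|).card : ℝ) := by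
  set T := Finset.univ.filter fun i => s / (2 * t) ≤ |Z i| with hT
  have h1 : Z ⬝ᵥ Z ≤ T.card * (t * l * s) ^ 2 + n * (s / (2 * t)) ^ 2 := by
    calc Z ⬝ᵥ Z ≤ ∑ i, ((if s / (2 * t) ≤ |Z i| then (t * l * s) ^ 2 else 0)
          + (s / (2 * t)) ^ 2) := by
          refine Finset.sum_le_sum fun i _ => ?_
          rw [← sq, ← sq_abs]
          split_ifs with hi
          · nlinarith [pow_le_pow_left₀ (abs_nonneg _) (hZ i) 2, sq_nonneg (s / (2 * t))]
          · rw [zero_add]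
            exact pow_le_pow_left₀ (abs_nonneg _) (not_le.1 hi).le 2
      _ = _ := by
          rw [Finset.sum_add_distrib, ← Finset.sum_filter, Finset.sum_const, Finset.sum_const]
          simp [T]
  have h2 : n * s ^ 2 ≤ T.card * t ^ 4 * l ^ 2 * s ^ 2 + n * s ^ 2 / 4 := by
    calc n * s ^ 2 ≤ t ^ 2 * (T.card * (t * l * s) ^ 2 + n * (s / (2 * t)) ^ 2) :=
          h.trans (by gcongr)
      _ = _ := by field_simp; ring
  have h3 : (n : ℝ) ≤ T.card * t ^ 4 * l ^ 2 + n / 4 := by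
    refine le_of_mul_le_mul_right ?_ (pow_pos hs 2)
    linarith
  rw [div_le_iff₀ (by positivity)]
  have : (0 : ℝ) ≤ n := by positivity
  linarith

/-- The deterministic core. Here `t` bounds all tails and `n / l` is the curvature of every
leave-one-out second moment; both `t` and `l` will be polylogarithmic. -/
theorem acre_on_good_event {n d k : ℕ} {x : Fin n → Fin d → ℝ} {ζ : Fin n → ℝ} {e : Fin d → ℝ}
    {t l c : ℝ} (hn : 1 ≤ n) (ht : 1 ≤ t) (hl : 1 ≤ l) (he0 : 0 < e ⬝ᵥ e)
    (hκ : ∀ i v, n / l * (v ⬝ᵥ v) ≤ v ⬝ᵥ loo x i *ᵥ v)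
    (hx : ∀ i j, |x i j| ≤ t) (hxe : ∀ i, |x i ⬝ᵥ e| ≤ t * √(e ⬝ᵥ e))
    (hxx : ∀ i j, j ≠ i → |x i ⬝ᵥ (loo x i)⁻¹ *ᵥ x j| ≤
      t * √(((loo x i)⁻¹ *ᵥ x j) ⬝ᵥ ((loo x i)⁻¹ *ᵥ x j)))
    (hxi : ∀ i, |x i ⬝ᵥ (loo x i)⁻¹ *ᵥ e| ≤
      t * √(((loo x i)⁻¹ *ᵥ e) ⬝ᵥ ((loo x i)⁻¹ *ᵥ e)))
    (hζ : ∀ i, |ζ i| ≤ t)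
    (hGζ : ∀ i, |(hat (Matrix.of x) *ᵥ ζ) i| ≤ t * √(∑ j, hat (Matrix.of x) i j ^ 2))
    (hcount : n / (2 * t ^ 4 * l ^ 2) ≤ ((Finset.univ.filter fun i =>
        √(e ⬝ᵥ e) / n / (2 * t) ≤ |infl (Matrix.of x) e i|).card : ℝ) →
      c * (n / (2 * t ^ 4 * l ^ 2)) ≤ ((Finset.univ.filter fun i =>
        √(e ⬝ᵥ e) / n / (2 * t) / 2 ≤ infl (Matrix.of x) e i * ζ i).card : ℝ))
    (hk : 1 ≤ k) (hc : 2 ≤ c * l) (hk1 : k * (t ^ 4 * l ^ 3) ≤ n)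
    (hd1 : 64 * t ^ 8 * l ^ 3 * d ≤ n)
    (hkd : 8 * t ^ 4 * l ^ 2 * (k * d ^ 2) ≤ n ^ 2)
    (hkd' : 8 * t ^ 4 * l ^ 2 * (k ^ 2 * d) ≤ n ^ 2)
    (hkd1 : 64 * t ^ 5 * l ^ 2 * (d + k * √d) ≤ n) :
    let G := hat (Matrix.of x)
    let R := ζ - G *ᵥ ζ
    let Z := infl (Matrix.of x) e
    let A := cumSum (sortDesc fun i => R i * Z i) k
    let B := 1 / (1 - rti (G.map (fun g => g ^ 2)) k)
      * rti (Matrix.diagonal R * G * Matrix.diagonal R) k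
      * rti (Matrix.diagonal Z * G * Matrix.diagonal Z) k
    0 < A - B ∧ 1 ≤ (A + B) / (A - B) ∧
      (A + B) / (A - B) ≤ 1 + 128 * t ^ 5 * l ^ 2 * ((d + k * √d) / n) := by
  intro G R Z
  have hn0 : (0 : ℝ) < n := by exact_mod_cast hn
  have hl0 : 0 < l := by linarith
  have ht0 : 0 < t := by linarith
  have hκ0 : 0 < n / l := by positivity
  have hX : ((Matrix.of x)ᵀ * Matrix.of x).PosDef :=
    posDef_of_coercive transpose_gram hκ0 (coercive_gram ⟨0, hn⟩ (hκ _))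
  set s := √(e ⬝ᵥ e) / n with hs
  have hs0 : 0 < s := by positivity
  have hes : e ⬝ᵥ e = s ^ 2 * n ^ 2 := by
    rw [hs, div_pow, Real.sq_sqrt he0.le]; field_simp
  have hZ : ∀ i, |Z i| ≤ t * l * s := fun i => by
    refine (abs_infl_le hκ0 ht0.le e i (hκ i) (hxi i)).trans_eq ?_
    rw [hs]; field_simp
  have hGd : ∀ i, G i i ≤ d * t ^ 2 * l / n := fun i => by
    refine (hat_diag_le hκ0 i (hκ i) (hx i)).trans_eq ?_
    field_simp
  have hG0 : ∀ i, 0 ≤ G i i := fun i => by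
    have h : 0 ≤ hat (Matrix.of x) i i := by rw [← sum_hat_sq hX i]; positivity
    exact h
  have hGζ' : ∀ i, |(G *ᵥ ζ) i| ≤ t * √(d * t ^ 2 * l / n) := fun i => by
    refine (hGζ i).trans ?_
    rw [sum_hat_sq hX i]
    gcongr
    exact hGd i
  have hsmall : √(d * t ^ 2 * l / n) ≤ 1 / (8 * t ^ 3 * l) := by
    refine Real.sqrt_le_iff.2 ⟨by positivity, ?_⟩
    rw [div_pow, div_le_div_iff₀ hn0 (by positivity)]
    calc d * t ^ 2 * l * (8 * t ^ 3 * l) ^ 2 = 64 * t ^ 8 * l ^ 3 * d := by ring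
      _ ≤ _ := by linarith
  have ht3 : 1 ≤ t ^ 3 := one_le_pow₀ ht
  have hsmall1 : √(d * t ^ 2 * l / n) ≤ 1 := by
    refine hsmall.trans ?_
    rw [div_le_one (by positivity)]
    nlinarith
  have hR : ∀ i, |R i| ≤ 2 * t := fun i => by
    calc |R i| ≤ |ζ i| + |(G *ᵥ ζ) i| := abs_sub _ _
      _ ≤ t + t * 1 := add_le_add (hζ i) ((hGζ' i).trans (by gcongr))
      _ = _ := by ring
  have hSk : (k : ℝ) ≤ ((Finset.univ.filter fun i => s / (8 * t) ≤ R i * Z i).card : ℝ) := by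
    have h1 : n / (2 * t ^ 4 * l ^ 2) ≤
        ((Finset.univ.filter fun i => s / (2 * t) ≤ |Z i|).card : ℝ) := by
      refine le_card_large hs0 ht0 hl0 hZ ?_
      have := dotProduct_self_le_infl hX hxe
      rw [hes] at this
      refine le_of_mul_le_mul_right ?_ hn0
      linarith
    have h2 := hcount h1
    have h3 : (k : ℝ) ≤ c * (n / (2 * t ^ 4 * l ^ 2)) := by
      rw [← mul_div_assoc, le_div_iff₀ (by positivity)]
      refine le_of_mul_le_mul_right ?_ hl0
      calc (k : ℝ) * (2 * t ^ 4 * l ^ 2) * l = 2 * ((k : ℝ) * (t ^ 4 * l ^ 3)) := by ring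
        _ ≤ 2 * (n : ℝ) := by gcongr
        _ ≤ c * l * (n : ℝ) := by gcongr
        _ = _ := by ring
    refine (h3.trans h2).trans ?_
    refine Nat.cast_le.2 (Finset.card_le_card fun i hi => ?_)
    simp only [Finset.mem_filter, Finset.mem_univ, true_and] at hi ⊢
    -- The leakage uses up at most half of the `s / (4 * t)` guaranteed for `Z i * ζ i`.
    have h4 : |(G *ᵥ ζ) i * Z i| ≤ s / (8 * t) := by
      rw [abs_mul]
      calc |(G *ᵥ ζ) i| * |Z i| ≤ (t * (1 / (8 * t ^ 3 * l))) * (t * l * s) := by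
            gcongr
            · exact (hGζ' i).trans (by gcongr)
            · exact hZ i
        _ = s / (8 * t) := by field_simp
    have h5 := (abs_le.1 h4).2
    have h6 : R i * Z i = Z i * ζ i - (G *ᵥ ζ) i * Z i := by
      simp only [R, Pi.sub_apply]; ring
    have h7 : s / (2 * t) / 2 = s / (8 * t) + s / (8 * t) := by field_simp; norm_num
    rw [h6]
    linarith
  have hL : (d * t ^ 2 * l / n) ^ 2 = t ^ 4 * l ^ 2 * d ^ 2 / n ^ 2 := by
    rw [div_pow]; ring
  have hO : (√d * t ^ 2 * l / n) ^ 2 = t ^ 4 * l ^ 2 * d / n ^ 2 := by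
    rw [div_pow, mul_pow, mul_pow, Real.sq_sqrt (by positivity)]; ring
  -- The value of `ρ` is exactly `2 r z (D + k O) / a`.
  have := ratio_bound (G := G) (R := R) (Z := Z) (D := d * t ^ 2 * l / n)
    (O := √d * t ^ 2 * l / n) (r := 2 * t) (z := t * l * s) (a := s / (8 * t))
    (ρ := 32 * t ^ 5 * l ^ 2 * ((d + k * √d) / n)) hk (by positivity) (by positivity)
    (by positivity) (by positivity) (by positivity)
    (fun i => by rw [abs_of_nonneg (hG0 i)]; exact hGd i)
    (fun i j hji => by
      refine (abs_hat_le hκ0 ht0.le i j (hκ i) (hx j) (hxx i j hji)).trans_eq ?_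
      field_simp)
    hR hZ (by exact_mod_cast hSk)
    (by
      rw [hL, hO]
      have : (k : ℝ) * (t ^ 4 * l ^ 2 * d ^ 2 / n ^ 2 + k * (t ^ 4 * l ^ 2 * d / n ^ 2))
        = (t ^ 4 * l ^ 2 * (k * d ^ 2) + t ^ 4 * l ^ 2 * (k ^ 2 * d)) / n ^ 2 := by ring
      rw [this, div_le_iff₀ (by positivity)]
      linarith)
    (by
      refine le_of_eq ?_
      field_simp
      ring)
    (by
      rw [← mul_div_assoc, div_le_iff₀ hn0]
      linarith)
  intro A B
  refine ⟨this.1, this.2.1, this.2.2.trans_eq (by ring)⟩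

/-! ### Probability on product spaces -/

/-- Fubini in coordinate `i`: it suffices to bound the conditional probability given all other
coordinates. -/
theorem pi_le_of_update {n : ℕ} {E : Type*} [MeasurableSpace E] {ν : Measure E}
    [IsProbabilityMeasure ν] {B : Set (Fin n → E)} (hB : MeasurableSet B) (i : Fin n)
    {q : ENNReal} (h : ∀ x, ν {y | Function.update x i y ∈ B} ≤ q) :
    Measure.pi (fun _ : Fin n => ν) B ≤ q := by
  have := lintegral_le_of_lmarginal_le (μ := fun _ : Fin n => ν) {i}
    (f := B.indicator 1) (g := fun _ => q) (measurable_one.indicator hB) measurable_const ?_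
  · rwa [lintegral_indicator_one hB, lintegral_const, measure_univ, mul_one] at this
  · intro x
    rw [lmarginal_singleton, lmarginal_singleton]
    simp only [lintegral_const, measure_univ, mul_one]
    refine le_trans (le_of_eq ?_) (h x)
    have hm : MeasurableSet {y | Function.update x i y ∈ B} :=
      (measurable_update x) hB
    rw [← lintegral_indicator_one hm]
    rfl

theorem prod_le_of_section {α β : Type*} [MeasurableSpace α] [MeasurableSpace β] {μ : Measure α}
    {ν : Measure β} [IsProbabilityMeasure μ] [IsProbabilityMeasure ν] {B : Set (α × β)}
    (hB : MeasurableSet B) {q : ENNReal} (h : ∀ x, ν (Prod.mk x ⁻¹' B) ≤ q) :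
    (μ.prod ν) B ≤ q := by
  rw [Measure.prod_apply hB]
  calc ∫⁻ x, ν (Prod.mk x ⁻¹' B) ∂μ ≤ ∫⁻ _, q ∂μ := lintegral_mono h
    _ = q := by simp

theorem prod_fst_eq {α β : Type*} [MeasurableSpace α] [MeasurableSpace β] (μ : Measure α)
    (ν : Measure β) [IsProbabilityMeasure μ] [IsProbabilityMeasure ν] (S : Set α) :
    (μ.prod ν) {p | p.1 ∈ S} = μ S := by
  have : {p : α × β | p.1 ∈ S} = S ×ˢ Set.univ := by ext; simp
  rw [this, Measure.prod_prod, measure_univ, mul_one]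

/-- Lower tail of the number of successes in independent trials. -/
theorem pi_card_lt_le {n : ℕ} {E : Type*} [MeasurableSpace E] {ν : Measure E}
    [IsProbabilityMeasure ν] {S : Fin n → E → Prop} [∀ i, DecidablePred (S i)]
    (hF : ∀ i, MeasurableSet {y | S i y}) (I : Finset (Fin n)) {p m : ℝ} (hp : 0 ≤ p)
    (hI : ∀ i ∈ I, p ≤ ν.real {y | S i y}) (hm : m ≤ I.card) :
    Measure.pi (fun _ : Fin n => ν)
      {x | ((Finset.univ.filter fun i => S i (x i)).card : ℝ) < p / 4 * m} ≤
      ENNReal.ofReal (Real.exp (-(p / 4 * m))) := by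
  set F : Fin n → Set E := fun i => {y | S i y}
  set P := Measure.pi (fun _ : Fin n => ν)
  -- Chernoff with parameter `-1`: `f i` is the exponential of minus the indicator, with mean `1 - a
  -- ν(F i) ≤ exp (-p / 2)` on `I` since `a ≥ 1/2`. Markov's inequality gives back half of the
  -- exponent.
  set a : ℝ := 1 - Real.exp (-1) with ha
  have ha1 : 1 / 2 ≤ a := by
    have : Real.exp (-1) ≤ 1 / 2 := by
      rw [Real.exp_neg, inv_le_comm₀ (Real.exp_pos _) (by norm_num)]
      have := Real.add_one_le_exp 1
      norm_num at this ⊢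
      linarith
    rw [ha]; linarith
  have ha2 : a ≤ 1 := by rw [ha]; linarith [Real.exp_pos (-1)]
  set f : Fin n → E → ℝ := fun i y => 1 - a * (F i).indicator 1 y with hf
  have hf01 : ∀ i y, f i y = Real.exp (-(if S i y then 1 else 0)) := by
    intro i y
    by_cases h : S i y <;> simp [hf, h, ha, F]
  have hint : ∀ i, ∫ y, f i y ∂ν = 1 - a * ν.real (F i) := by
    intro i
    have : Integrable ((F i).indicator (1 : E → ℝ)) ν :=
      (integrable_const (1 : ℝ)).indicator (hF i)
    rw [hf, integral_sub (integrable_const _) (this.const_mul a), integral_const_mul,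
      integral_indicator_one (hF i)]
    simp [F]
  have hprod : ∫ x, ∏ i, f i (x i) ∂P ≤ Real.exp (-(p / 2 * m)) := by
    rw [integral_fintype_prod_eq_prod]
    simp only [hint]
    have hle1 : ∀ i, 1 - a * ν.real (F i) ≤ 1 := fun i => by
      have : 0 ≤ ν.real (F i) := measureReal_nonneg
      nlinarith
    have hnn : ∀ i, 0 ≤ 1 - a * ν.real (F i) := fun i => by
      have : ν.real (F i) ≤ 1 := measureReal_le_one
      have : 0 ≤ ν.real (F i) := measureReal_nonneg
      nlinarith
    calc ∏ i, (1 - a * ν.real (F i)) ≤ ∏ i, (if i ∈ I then Real.exp (-(p / 2)) else 1) := by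
          refine Finset.prod_le_prod (fun i _ => hnn i) fun i _ => ?_
          split_ifs with hi
          · have h1 := hI i hi
            have h2 := Real.add_one_le_exp (-(p / 2))
            nlinarith
          · exact hle1 i
      _ = Real.exp (-(p / 2 * I.card)) := by
          rw [Finset.prod_ite_mem, Finset.univ_inter, Finset.prod_const, ← Real.exp_nat_mul]
          congr 1; ring
      _ ≤ _ := by
          apply Real.exp_le_exp.2
          have := mul_le_mul_of_nonneg_left hm (by positivity : 0 ≤ p / 2)
          linarith
  have hval : ∀ x : Fin n → E, ∏ i, f i (x i) =
      Real.exp (-((Finset.univ.filter fun i => S i (x i)).card : ℝ)) := by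
    intro x
    simp only [hf01]
    rw [← Real.exp_sum, Finset.sum_neg_distrib]
    simp
  have hfm : ∀ i, Measurable (f i) := fun i =>
    measurable_const.sub ((measurable_one.indicator (hF i)).const_mul a)
  have hfi : Integrable (fun x : Fin n → E => ∏ i, f i (x i)) P := by
    refine Integrable.of_bound (C := 1) (Finset.measurable_prod _ fun i _ =>
      (hfm i).comp (measurable_pi_apply i)).aestronglyMeasurable (ae_of_all _ fun x => ?_)
    rw [hval, Real.norm_of_nonneg (Real.exp_pos _).le, Real.exp_le_one_iff]
    simp
  have hmarkov := mul_meas_ge_le_integral_of_nonneg (μ := P)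
    (ae_of_all _ fun x => by rw [hval]; exact (Real.exp_pos _).le) hfi (Real.exp (-(p / 4 * m)))
  have hsub : {x | ((Finset.univ.filter fun i => S i (x i)).card : ℝ) < p / 4 * m} ⊆
      {x : Fin n → E | Real.exp (-(p / 4 * m)) ≤ ∏ i, f i (x i)} := by
    intro x hx
    have hx' : ((Finset.univ.filter fun i => S i (x i)).card : ℝ) < p / 4 * m := hx
    change Real.exp (-(p / 4 * m)) ≤ ∏ i, f i (x i)
    rw [hval]
    exact Real.exp_le_exp.2 (by linarith)
  refine (measure_mono hsub).trans ?_
  rw [← ofReal_measureReal (measure_ne_top _ _)]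
  refine ENNReal.ofReal_le_ofReal ?_
  refine le_of_mul_le_mul_left (hmarkov.trans (hprod.trans_eq ?_)) (Real.exp_pos _)
  rw [← Real.exp_add]
  congr 1; ring

/-- Two-sided Gaussian tail for linear forms. -/
theorem pi_gaussian_abs_gt_le {n : ℕ} (a : Fin n → ℝ) {t : ℝ} (ht : 0 ≤ t) :
    Measure.pi (fun _ : Fin n => gaussianReal 0 1) {ζ | t * √(∑ j, a j ^ 2) < |∑ j, a j * ζ j|} ≤
      ENNReal.ofReal (2 * Real.exp (-(t ^ 2 / 2))) := by
  set P := Measure.pi (fun _ : Fin n => gaussianReal 0 1)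
  have one : ∀ a : Fin n → ℝ, 0 < ∑ j, a j ^ 2 →
      P.real {ζ | t * √(∑ j, a j ^ 2) ≤ ∑ j, a j * ζ j} ≤ Real.exp (-(t ^ 2 / 2)) := by
    intro a hσ
    set σ := √(∑ j, a j ^ 2) with hσdef
    have hσ0 : 0 < σ := Real.sqrt_pos.2 hσ
    have hσ2 : ∑ j, a j ^ 2 = σ ^ 2 := (Real.sq_sqrt hσ.le).symm
    have hexp : ∀ ζ : Fin n → ℝ, Real.exp (t / σ * ∑ j, a j * ζ j) =
        ∏ j, Real.exp (t / σ * a j * ζ j) := fun ζ => by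
      rw [← Real.exp_sum, Finset.mul_sum]
      simp only [mul_assoc]
    have hmgf : mgf (fun ζ : Fin n → ℝ => ∑ j, a j * ζ j) P (t / σ) = Real.exp (t ^ 2 / 2) := by
      rw [mgf]
      simp only [hexp]
      rw [integral_fintype_prod_eq_prod (f := fun j y => Real.exp (t / σ * a j * y))]
      have : ∀ j, ∫ y, Real.exp (t / σ * a j * y) ∂(gaussianReal 0 1) =
          Real.exp ((t / σ * a j) ^ 2 / 2) := fun j => by
        have := mgf_gaussianReal (p := gaussianReal 0 1) (X := id) (μ := 0) (v := 1) (by simp)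
          (t / σ * a j)
        simpa [mgf] using this
      simp only [this]
      rw [← Real.exp_sum]
      congr 1
      have : ∀ j, (t / σ * a j) ^ 2 / 2 = t ^ 2 / (2 * σ ^ 2) * a j ^ 2 := fun j => by
        field_simp
      simp only [this]
      rw [← Finset.mul_sum, hσ2]
      field_simp
    have hint : Integrable (fun ζ : Fin n → ℝ => Real.exp (t / σ * ∑ j, a j * ζ j)) P := by
      simp only [hexp]
      exact Integrable.fintype_prod (f := fun j y => Real.exp (t / σ * a j * y)) fun j =>
        integrable_exp_mul_gaussianReal _
    refine (measure_ge_le_exp_mul_mgf _ (by positivity : 0 ≤ t / σ) hint).trans_eq ?_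
    rw [hmgf, ← Real.exp_add]
    congr 1
    field_simp
    ring
  rcases (Finset.sum_nonneg fun j _ => sq_nonneg (a j) :
    0 ≤ ∑ j, a j ^ 2).eq_or_lt with h0 | h0
  -- With variance zero the event is empty because its inequality is strict.
  · have ha : ∀ j, a j = 0 := fun j => by
      have := (Finset.sum_eq_zero_iff_of_nonneg fun j _ => sq_nonneg (a j)).1 h0.symm j
        (Finset.mem_univ j)
      simpa using this
    simp [ha]
  · have h1 := one a h0
    have h2 := one (fun j => -a j) (by simpa using h0)
    simp only [neg_sq, neg_mul, Finset.sum_neg_distrib] at h2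
    have hsub : {ζ : Fin n → ℝ | t * √(∑ j, a j ^ 2) < |∑ j, a j * ζ j|} ⊆
        {ζ | t * √(∑ j, a j ^ 2) ≤ ∑ j, a j * ζ j} ∪
        {ζ | t * √(∑ j, a j ^ 2) ≤ -∑ j, a j * ζ j} := by
      intro ζ hζ
      have hζ' : t * √(∑ j, a j ^ 2) < |∑ j, a j * ζ j| := hζ
      rcases lt_abs.1 hζ' with h | h
      · exact Or.inl h.le
      · exact Or.inr h.le
    rw [← ofReal_measureReal]
    refine ENNReal.ofReal_le_ofReal ?_
    calc P.real _ ≤ P.real _ := measureReal_mono hsub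
      _ ≤ _ := measureReal_union_le _ _
      _ ≤ _ := by linarith

/-! ### Measurability of matrix-valued functions -/

section Measurable

variable {Ω : Type*} [MeasurableSpace Ω] {d : ℕ}

theorem measurable_det {A : Ω → Matrix (Fin d) (Fin d) ℝ}
    (hA : ∀ i j, Measurable fun ω => A ω i j) : Measurable fun ω => (A ω).det := by
  simp only [Matrix.det_apply]
  exact Finset.measurable_sum _ fun σ _ =>
    (Finset.measurable_prod _ fun i _ => hA _ _).const_smul _

theorem measurable_inv_apply {A : Ω → Matrix (Fin d) (Fin d) ℝ}
    (hA : ∀ i j, Measurable fun ω => A ω i j) (i j : Fin d) :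
    Measurable fun ω => (A ω)⁻¹ i j := by
  simp only [Matrix.inv_def, Ring.inverse_eq_inv', Matrix.smul_apply, Matrix.adjugate_apply,
    smul_eq_mul]
  refine (measurable_det hA).inv.mul (measurable_det fun a b => ?_)
  simp only [Matrix.updateRow_apply]
  split_ifs
  · exact measurable_const
  · exact hA a b

theorem measurable_mulVec {m : ℕ} {A : Ω → Matrix (Fin m) (Fin d) ℝ} {v : Ω → Fin d → ℝ}
    (hA : ∀ i j, Measurable fun ω => A ω i j) (hv : Measurable v) :
    Measurable fun ω => A ω *ᵥ v ω :=
  measurable_pi_lambda _ fun i => Finset.measurable_sum Finset.univ fun j _ =>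
    (hA i j).mul ((measurable_pi_apply j).comp hv)

theorem measurable_dotProduct {u v : Ω → Fin d → ℝ} (hu : Measurable u) (hv : Measurable v) :
    Measurable fun ω => u ω ⬝ᵥ v ω :=
  Finset.measurable_sum Finset.univ fun j _ =>
    ((measurable_pi_apply j).comp hu).mul ((measurable_pi_apply j).comp hv)

theorem measurable_loo_apply {n : ℕ} (i : Fin n) (a b : Fin d) :
    Measurable fun x : Fin n → Fin d → ℝ => loo x i a b := by
  simp only [loo, Matrix.sum_apply, Matrix.vecMulVec_apply]
  fun_prop

theorem measurable_gram_inv_apply {n : ℕ} (a b : Fin d) :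
    Measurable fun x : Fin n → Fin d → ℝ => ((Matrix.of x)ᵀ * Matrix.of x)⁻¹ a b := by
  refine measurable_inv_apply (fun i j => ?_) a b
  simp only [Matrix.mul_apply, Matrix.transpose_apply, Matrix.of_apply]
  fun_prop

theorem measurable_hat_apply {n : ℕ} (i j : Fin n) :
    Measurable fun x : Fin n → Fin d → ℝ => hat (Matrix.of x) i j := by
  simp only [hat_apply]
  exact measurable_dotProduct (measurable_pi_apply i)
    (measurable_mulVec measurable_gram_inv_apply (measurable_pi_apply j))

theorem measurable_infl_apply {n : ℕ} (e : Fin d → ℝ) (i : Fin n) :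
    Measurable fun x : Fin n → Fin d → ℝ => infl (Matrix.of x) e i := by
  simp only [infl_apply]
  exact measurable_dotProduct (measurable_pi_apply i)
    (measurable_mulVec measurable_gram_inv_apply measurable_const)

end Measurable

theorem loo_update {n d : ℕ} (x : Fin n → Fin d → ℝ) (i : Fin n) (y : Fin d → ℝ) :
    loo (Function.update x i y) i = loo x i := by
  refine Finset.sum_congr rfl fun j hj => ?_
  rw [Function.update_of_ne (Finset.ne_of_mem_erase hj)]

/-! ### Isotropic distributions -/

/-- Identity second moment and stretched-exponential tails of all one-dimensional marginals. -/
structure IsotropicTail {d : ℕ} (C c t₀ : ℝ) (ν : Measure (Fin d → ℝ)) : Prop where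
  isProbability : IsProbabilityMeasure ν
  integrable : ∀ v : Fin d → ℝ, Integrable (fun x => (v ⬝ᵥ x) ^ 2) ν
  second : ∀ v : Fin d → ℝ, ∫ x, (v ⬝ᵥ x) ^ 2 ∂ν = v ⬝ᵥ v
  tail : ∀ v : Fin d → ℝ, v ⬝ᵥ v = 1 → ∀ t : ℝ, t₀ ≤ t →
    ν {x | t < |v ⬝ᵥ x|} ≤ ENNReal.ofReal (Real.exp (-(c * t ^ C)))

theorem measurable_dotProduct_const {d : ℕ} (v : Fin d → ℝ) :
    Measurable fun x : Fin d → ℝ => v ⬝ᵥ x :=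
  measurable_dotProduct measurable_const measurable_id

theorem exists_unit_smul {d : ℕ} {v : Fin d → ℝ} (hv : 0 < v ⬝ᵥ v) :
    ∃ u : Fin d → ℝ, u ⬝ᵥ u = 1 ∧ v = √(v ⬝ᵥ v) • u := by
  have h0 : √(v ⬝ᵥ v) ≠ 0 := (Real.sqrt_pos.2 hv).ne'
  refine ⟨(√(v ⬝ᵥ v))⁻¹ • v, ?_, ?_⟩
  · rw [smul_dotProduct, dotProduct_smul, smul_eq_mul, smul_eq_mul, ← mul_assoc, ← mul_inv,
      Real.mul_self_sqrt hv.le, inv_mul_cancel₀ hv.ne']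
  · rw [smul_smul, mul_inv_cancel₀ h0, one_smul]

namespace IsotropicTail

variable {d : ℕ} {C c t₀ : ℝ} {ν : Measure (Fin d → ℝ)}

theorem tail_smul (h : IsotropicTail C c t₀ ν) (v : Fin d → ℝ) {t : ℝ} (ht : t₀ ≤ t) :
    ν {x | t * √(v ⬝ᵥ v) < |x ⬝ᵥ v|} ≤ ENNReal.ofReal (Real.exp (-(c * t ^ C))) := by
  rcases (dotProduct_self_nonneg' v).eq_or_lt with h0 | h0
  · have : v = 0 := dotProduct_self_eq_zero.1 h0.symm
    simp [this]
  · obtain ⟨u, hu, hv⟩ := exists_unit_smul h0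
    have hr := Real.sqrt_pos.2 h0
    refine le_trans (measure_mono fun x hx => ?_) (h.tail u hu t ht)
    have hx' : t * √(v ⬝ᵥ v) < |x ⬝ᵥ v| := hx
    change t < |u ⬝ᵥ x|
    generalize √(v ⬝ᵥ v) = r at *
    rw [hv, dotProduct_smul, smul_eq_mul, abs_mul, abs_of_pos hr, dotProduct_comm, mul_comm] at hx'
    exact lt_of_mul_lt_mul_left hx' hr.le

/-- Given the other rows, `f x` is a fixed vector. The intended `f` is `(loo x i)⁻¹` applied to `e`
or to another row. -/
theorem pi_tail_of_invariant (h : IsotropicTail C c t₀ ν) {n : ℕ} (i : Fin n)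
    {f : (Fin n → Fin d → ℝ) → Fin d → ℝ} (hf : Measurable f)
    (hinv : ∀ x y, f (Function.update x i y) = f x) {t : ℝ} (ht : t₀ ≤ t) :
    Measure.pi (fun _ : Fin n => ν) {x | t * √(f x ⬝ᵥ f x) < |x i ⬝ᵥ f x|} ≤
      ENNReal.ofReal (Real.exp (-(c * t ^ C))) := by
  have := h.isProbability
  refine pi_le_of_update ?_ i fun x => ?_
  · exact measurableSet_lt ((measurable_dotProduct hf hf).sqrt.const_mul t)
      (measurable_dotProduct (measurable_pi_apply i) hf).abs
  · refine le_trans (measure_mono fun y hy => ?_) (h.tail_smul (f x) ht)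
    have hy' : t * √(f (Function.update x i y) ⬝ᵥ f (Function.update x i y)) <
      |Function.update x i y i ⬝ᵥ f (Function.update x i y)| := hy
    rw [hinv, Function.update_self] at hy'
    exact hy'

end IsotropicTail

/-- A bound on fourth moments that depends only on the tail parameters. -/
theorem exists_fourth_moment_bound {C c : ℝ} (t₀ : ℝ) (hC : 0 < C) (hc : 0 < c) :
    ∃ K : ℝ, 0 < K ∧ ∀ {Ω : Type} [MeasurableSpace Ω] (P : Measure Ω) [IsProbabilityMeasure P]
      (f : Ω → ℝ), Measurable f →
      (∀ t : ℝ, t₀ ≤ t → P {x | t < |f x|} ≤ ENNReal.ofReal (Real.exp (-(c * t ^ C)))) →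
      Integrable (fun x => f x ^ 4) P ∧ ∫ x, f x ^ 4 ∂P ≤ K := by
  -- With this factor the tail bound is at least 1 for `0 < t < t₀`, hence holds for all `t > 0` and
  -- can be integrated in the layer-cake formula.
  set M := Real.exp (c * |t₀| ^ C) with hM
  have hM1 : 1 ≤ M := Real.one_le_exp (by positivity)
  have hint : IntegrableOn (fun t : ℝ => 4 * (M * (t ^ (3 : ℝ) * Real.exp (-c * t ^ C))))
      (Set.Ioi 0) :=
    ((integrableOn_rpow_mul_exp_neg_mul_rpow (by norm_num) hC hc).const_mul M).const_mul 4
  set K₀ := ∫ t in Set.Ioi (0 : ℝ), 4 * (M * (t ^ (3 : ℝ) * Real.exp (-c * t ^ C))) with hK₀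
  have hK₀nn : 0 ≤ K₀ := setIntegral_nonneg measurableSet_Ioi fun t ht => by
    have : (0 : ℝ) < t := ht
    positivity
  refine ⟨K₀ + 1, by linarith, ?_⟩
  intro Ω _ P _ f hf htail
  have htail' : ∀ t : ℝ, 0 < t →
      P {x | t < |f x|} ≤ ENNReal.ofReal (M * Real.exp (-c * t ^ C)) := by
    intro t ht
    rcases le_or_gt t₀ t with h | h
    · refine (htail t h).trans (ENNReal.ofReal_le_ofReal ?_)
      rw [neg_mul]
      exact le_mul_of_one_le_left (Real.exp_pos _).le hM1
    · refine prob_le_one.trans ?_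
      rw [ENNReal.one_le_ofReal, hM, ← Real.exp_add]
      refine Real.one_le_exp ?_
      have h1 : t ^ C ≤ |t₀| ^ C :=
        Real.rpow_le_rpow ht.le (h.le.trans (le_abs_self _)) hC.le
      nlinarith
  have hlint : ∫⁻ x, ENNReal.ofReal (f x ^ 4) ∂P ≤ ENNReal.ofReal K₀ := by
    have h4 : ∀ x, f x ^ 4 = |f x| ^ (4 : ℝ) := fun x => by
      rw [show (4 : ℝ) = ((4 : ℕ) : ℝ) by norm_num, Real.rpow_natCast,
        show |f x| ^ 4 = (|f x| ^ 2) ^ 2 by ring, sq_abs]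
      ring
    simp only [h4]
    rw [lintegral_rpow_eq_lintegral_meas_lt_mul P (ae_of_all _ fun x => abs_nonneg (f x))
      hf.abs.aemeasurable (by norm_num : (0 : ℝ) < 4), hK₀,
      ofReal_integral_eq_lintegral_ofReal hint
      ((ae_restrict_iff' measurableSet_Ioi).2 (ae_of_all _ fun t ht => by
        have : (0 : ℝ) < t := ht
        simp only [Pi.zero_apply]
        positivity)), ← lintegral_const_mul' _ _ ENNReal.ofReal_ne_top]
    refine setLIntegral_mono' measurableSet_Ioi fun t ht => ?_
    have ht0 : (0 : ℝ) < t := ht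
    calc ENNReal.ofReal 4 * (P {a | t < |f a|} * ENNReal.ofReal (t ^ ((4 : ℝ) - 1)))
        ≤ ENNReal.ofReal 4 * (ENNReal.ofReal (M * Real.exp (-c * t ^ C)) *
          ENNReal.ofReal (t ^ ((4 : ℝ) - 1))) := by
          gcongr
          exact htail' t ht0
      _ = _ := by
          rw [← ENNReal.ofReal_mul (by positivity), ← ENNReal.ofReal_mul (by norm_num)]
          norm_num
          congr 1
          ring_nf
  have hnn : 0 ≤ᵐ[P] fun x => f x ^ 4 := ae_of_all _ fun x => by positivity
  have hmeas : AEStronglyMeasurable (fun x => f x ^ 4) P := (hf.pow_const 4).aestronglyMeasurable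
  have hI : Integrable (fun x => f x ^ 4) P :=
    (lintegral_ofReal_ne_top_iff_integrable hmeas hnn).1
      (hlint.trans_lt ENNReal.ofReal_lt_top).ne
  refine ⟨hI, ?_⟩
  rw [integral_eq_lintegral_of_nonneg_ae hnn hmeas]
  refine (ENNReal.toReal_le_of_le_ofReal hK₀nn hlint).trans (by linarith)

/-- Marginals of isotropic distributions are bounded away from zero with constant probability. -/
theorem exists_small_ball {C c : ℝ} (t₀ : ℝ) (hC : 0 < C) (hc : 0 < c) :
    ∃ p : ℝ, 0 < p ∧ ∀ {d : ℕ} {ν : Measure (Fin d → ℝ)}, IsotropicTail C c t₀ ν →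
      ∀ v : Fin d → ℝ, 1 / 4 ≤ v ⬝ᵥ v → p ≤ ν.real {x | 1 / 16 ≤ (v ⬝ᵥ x) ^ 2} := by
  obtain ⟨K, hK, hfour⟩ := exists_fourth_moment_bound t₀ hC hc
  refine ⟨1 / (2 * K), by positivity, ?_⟩
  intro d ν h v hv
  have := h.isProbability
  have hv0 : 0 < v ⬝ᵥ v := by linarith
  obtain ⟨u, hu, hvu⟩ := exists_unit_smul hv0
  set F := {x : Fin d → ℝ | 1 / 4 ≤ (u ⬝ᵥ x) ^ 2} with hF
  have hFm : MeasurableSet F :=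
    measurableSet_le measurable_const ((measurable_dotProduct_const u).pow_const 2)
  have hFv : F ⊆ {x | 1 / 16 ≤ (v ⬝ᵥ x) ^ 2} := by
    intro x hx
    have hx' : 1 / 4 ≤ (u ⬝ᵥ x) ^ 2 := hx
    change 1 / 16 ≤ (v ⬝ᵥ x) ^ 2
    have : (v ⬝ᵥ x) ^ 2 = (v ⬝ᵥ v) * (u ⬝ᵥ x) ^ 2 := by
      conv_lhs => rw [hvu]
      rw [smul_dotProduct, smul_eq_mul, mul_pow, Real.sq_sqrt hv0.le]
    rw [this]
    nlinarith
  refine le_trans ?_ (measureReal_mono hFv)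
  obtain ⟨hI4, h4⟩ := hfour ν (fun x => u ⬝ᵥ x) (measurable_dotProduct_const u) (h.tail u hu)
  have hI1 : Integrable (F.indicator (1 : (Fin d → ℝ) → ℝ)) ν :=
    (integrable_const (1 : ℝ)).indicator hFm
  have hI2 : Integrable (fun x => 1 / 4 + 1 / (4 * K) * (u ⬝ᵥ x) ^ 4) ν :=
    (integrable_const _).add (hI4.const_mul _)
  -- Pointwise, `y² ≤ 1/4` off `F` and `y² ≤ y⁴ / (4 K) + K` on `F`. Integrating gives `1 ≤ 1/4 +
  -- 1/4 + K ν(F)`, whence `1 / (2 * K)`.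
  have hle : ∫ x, (u ⬝ᵥ x) ^ 2 ∂ν ≤
      ∫ x, (1 / 4 + 1 / (4 * K) * (u ⬝ᵥ x) ^ 4 + K * F.indicator 1 x) ∂ν := by
    refine integral_mono (h.integrable u)
      (hI2.add (hI1.const_mul K)) fun x => ?_
    have hq : 0 ≤ (u ⬝ᵥ x) ^ 4 := by positivity
    by_cases hx : x ∈ F
    · have h1 : 0 ≤ 1 / (4 * K) * ((u ⬝ᵥ x) ^ 2 - 2 * K) ^ 2 := by positivity
      have h2 : 1 / (4 * K) * ((u ⬝ᵥ x) ^ 2 - 2 * K) ^ 2 =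
          1 / (4 * K) * (u ⬝ᵥ x) ^ 4 - (u ⬝ᵥ x) ^ 2 + K := by
        field_simp; ring
      simp only [hx, Set.indicator_of_mem, Pi.one_apply]
      linarith
    · have hx' : (u ⬝ᵥ x) ^ 2 < 1 / 4 := not_le.1 hx
      have h1 : 0 ≤ 1 / (4 * K) * (u ⬝ᵥ x) ^ 4 := by positivity
      simp only [hx, not_false_eq_true, Set.indicator_of_notMem]
      linarith
  rw [h.second, hu, integral_add hI2 (hI1.const_mul K),
    integral_add (integrable_const _) (hI4.const_mul _), integral_const_mul, integral_const_mul,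
    integral_indicator_one hFm, integral_const, probReal_univ, one_smul] at hle
  have h5 : 1 / (4 * K) * ∫ x, (u ⬝ᵥ x) ^ 4 ∂ν ≤ 1 / 4 := by
    calc _ ≤ 1 / (4 * K) * K := by gcongr
      _ = 1 / 4 := by field_simp
  rw [div_le_iff₀ (by positivity)]
  linarith

/-! ### A net argument -/

/-- The grid point with index `f` in the cube `[-1, 1]^d`. -/
noncomputable def gridPoint {d : ℕ} (N : ℕ) (f : Fin d → Fin (2 * N + 1)) : Fin d → ℝ :=
  fun j => (f j : ℕ) / (N : ℝ) - 1

theorem exists_gridPoint {d N : ℕ} (hN : 1 ≤ N) {v : Fin d → ℝ} (hv : ∀ j, |v j| ≤ 1) :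
    ∃ f : Fin d → Fin (2 * N + 1), ∀ j, |gridPoint N f j - v j| ≤ 1 / N := by
  have hN0 : (0 : ℝ) < N := by exact_mod_cast hN
  have hnn : ∀ j, 0 ≤ (v j + 1) * N := fun j => by
    have := (abs_le.1 (hv j)).1
    have : 0 ≤ v j + 1 := by linarith
    positivity
  refine ⟨fun j => ⟨⌊(v j + 1) * N⌋₊, ?_⟩, fun j => ?_⟩
  · rw [Nat.lt_succ_iff]
    refine Nat.floor_le_of_le ?_
    push_cast
    have := (abs_le.1 (hv j)).2
    nlinarith
  · have h1 := Nat.floor_le (hnn j)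
    have h2 := Nat.lt_floor_add_one ((v j + 1) * N)
    have h3 : gridPoint N (fun j => (⟨⌊(v j + 1) * N⌋₊, by
        rw [Nat.lt_succ_iff]
        refine Nat.floor_le_of_le ?_
        push_cast
        have := (abs_le.1 (hv j)).2
        nlinarith⟩ : Fin (2 * N + 1))) j - v j = (⌊(v j + 1) * N⌋₊ - (v j + 1) * N) / N := by
      simp only [gridPoint]
      field_simp
      ring
    rw [h3, abs_div, abs_of_pos hN0]
    gcongr
    rw [abs_le]
    constructor <;> linarith

theorem abs_dotProduct_le_of_abs_le {d : ℕ} {u w : Fin d → ℝ} {a b : ℝ} (ha : 0 ≤ a)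
    (hu : ∀ j, |u j| ≤ a) (hw : ∀ j, |w j| ≤ b) : |u ⬝ᵥ w| ≤ d * (a * b) := by
  calc |u ⬝ᵥ w| ≤ ∑ j, |u j * w j| := Finset.abs_sum_le_sum_abs _ _
    _ ≤ ∑ _j : Fin d, a * b := Finset.sum_le_sum fun j _ => by
        rw [abs_mul]
        exact mul_le_mul (hu j) (hw j) (abs_nonneg _) ha
    _ = _ := by simp

theorem abs_le_one_of_dotProduct_self {d : ℕ} {v : Fin d → ℝ} (hv : v ⬝ᵥ v = 1) (j : Fin d) :
    |v j| ≤ 1 := by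
  rw [← sq_le_one_iff_abs_le_one, ← hv, sq]
  exact Finset.single_le_sum (f := fun j => v j * v j) (fun i _ => mul_self_nonneg (v i))
    (Finset.mem_univ j)

/-- Rounding a unit vector to the grid changes each `⟨u, x j⟩` by at most `d t / N ≤ 1/8`, so `1/4`
at the grid point leaves `1/8` at `u`. The crude sup-norm rounding is affordable because `N` enters
only through `log N`. -/
theorem coercive_of_grid {n d N : ℕ} {x : Fin n → Fin d → ℝ} {t m : ℝ} (hN : 1 ≤ N)
    (hx : ∀ i j, |x i j| ≤ t) (ht : 1 ≤ t) (hNd : 8 * d * t ≤ N)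
    (hgrid : ∀ f : Fin d → Fin (2 * N + 1), 1 / 4 ≤ gridPoint N f ⬝ᵥ gridPoint N f →
      m ≤ ((Finset.univ.filter fun i => 1 / 16 ≤ (gridPoint N f ⬝ᵥ x i) ^ 2).card : ℝ))
    (i : Fin n) (v : Fin d → ℝ) : (m - 1) / 64 * (v ⬝ᵥ v) ≤ v ⬝ᵥ loo x i *ᵥ v := by
  have hN0 : (0 : ℝ) < N := by exact_mod_cast hN
  rcases (dotProduct_self_nonneg' v).eq_or_lt with h0 | h0
  · rw [← h0, dotProduct_loo_mulVec, mul_zero]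
    exact Finset.sum_nonneg fun _ _ => sq_nonneg _
  obtain ⟨u, hu, hvu⟩ := exists_unit_smul h0
  refine coercive_loo x ?_ i
  have hu1 := abs_le_one_of_dotProduct_self hu
  obtain ⟨f, hf⟩ := exists_gridPoint hN hu1
  set g := gridPoint N f
  have hdN : (d : ℝ) / N * t ≤ 1 / 8 := by
    rw [div_mul_eq_mul_div, div_le_iff₀ hN0]; linarith
  have hdN0 : (0 : ℝ) ≤ d / N := by positivity
  have hdN1 : (d : ℝ) / N ≤ 1 / 8 := by nlinarith
  have hg : 1 / 4 ≤ g ⬝ᵥ g := by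
    have h1 : |u ⬝ᵥ (g - u)| ≤ d * (1 * (1 / N)) :=
      abs_dotProduct_le_of_abs_le zero_le_one hu1 fun j => hf j
    have h2 : g ⬝ᵥ g = 1 + 2 * (u ⬝ᵥ (g - u)) + (g - u) ⬝ᵥ (g - u) := by
      rw [← hu]
      simp only [dotProduct_sub, sub_dotProduct, dotProduct_comm g u]
      ring
    have h3 := (abs_le.1 h1).1
    have h4 := dotProduct_self_nonneg' (g - u)
    have h5 : (d : ℝ) * (1 * (1 / N)) = d / N := by ring
    rw [h2]
    linarith
  refine (hgrid f hg).trans (Nat.cast_le.2 (Finset.card_le_card fun j hj => ?_))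
  simp only [Finset.mem_filter, Finset.mem_univ, true_and] at hj ⊢
  have h1 : |(g - u) ⬝ᵥ x j| ≤ d * (1 / N * t) :=
    abs_dotProduct_le_of_abs_le (by positivity) (fun l => hf l) (hx j)
  have h2 : 1 / 4 ≤ |g ⬝ᵥ x j| := by
    refine abs_le_of_sq_le_sq' ?_ (abs_nonneg _) |>.2
    rw [sq_abs]
    linarith
  have h3 : |g ⬝ᵥ x j| ≤ |(g - u) ⬝ᵥ x j| + |u ⬝ᵥ x j| := by
    have : g ⬝ᵥ x j = (g - u) ⬝ᵥ x j + u ⬝ᵥ x j := by rw [sub_dotProduct]; ring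
    rw [this]
    exact abs_add_le _ _
  have h4 : (d : ℝ) * (1 / N * t) = d / N * t := by ring
  have h5 : 1 / 8 ≤ |u ⬝ᵥ x j| := by linarith
  have h6 : 1 / 64 ≤ (u ⬝ᵥ x j) ^ 2 := by
    rw [← sq_abs]; nlinarith
  have h7 : (x j ⬝ᵥ v) ^ 2 = (v ⬝ᵥ v) * (u ⬝ᵥ x j) ^ 2 := by
    rw [dotProduct_comm]
    conv_lhs => rw [hvu]
    rw [smul_dotProduct, smul_eq_mul, mul_pow, Real.sq_sqrt h0.le]
  rw [h7]
  nlinarith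

theorem pi_grid_le {n d N : ℕ} {ν : Measure (Fin d → ℝ)} [IsProbabilityMeasure ν] {p : ℝ}
    (hp : 0 ≤ p) (h : ∀ v : Fin d → ℝ, 1 / 4 ≤ v ⬝ᵥ v → p ≤ ν.real {x | 1 / 16 ≤ (v ⬝ᵥ x) ^ 2}) :
    Measure.pi (fun _ : Fin n => ν) {x | ¬ ∀ f : Fin d → Fin (2 * N + 1),
      1 / 4 ≤ gridPoint N f ⬝ᵥ gridPoint N f → p / 4 * n ≤
        ((Finset.univ.filter fun i => 1 / 16 ≤ (gridPoint N f ⬝ᵥ x i) ^ 2).card : ℝ)} ≤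
      ENNReal.ofReal ((2 * N + 1) ^ d * Real.exp (-(p / 4 * n))) := by
  set P := Measure.pi (fun _ : Fin n => ν)
  set T : Finset (Fin d → Fin (2 * N + 1)) :=
    Finset.univ.filter fun f => 1 / 4 ≤ gridPoint N f ⬝ᵥ gridPoint N f with hT
  have hsub : {x : Fin n → Fin d → ℝ | ¬ ∀ f : Fin d → Fin (2 * N + 1),
      1 / 4 ≤ gridPoint N f ⬝ᵥ gridPoint N f → p / 4 * n ≤
        ((Finset.univ.filter fun i => 1 / 16 ≤ (gridPoint N f ⬝ᵥ x i) ^ 2).card : ℝ)} ⊆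
      ⋃ f ∈ T, {x | ((Finset.univ.filter fun i =>
        1 / 16 ≤ (gridPoint N f ⬝ᵥ x i) ^ 2).card : ℝ) < p / 4 * n} := by
    intro x hx
    have hx' : ¬ ∀ f : Fin d → Fin (2 * N + 1),
      1 / 4 ≤ gridPoint N f ⬝ᵥ gridPoint N f → p / 4 * n ≤
        ((Finset.univ.filter fun i => 1 / 16 ≤ (gridPoint N f ⬝ᵥ x i) ^ 2).card : ℝ) := hx
    push Not at hx'
    obtain ⟨f, hf, hlt⟩ := hx'
    exact Set.mem_biUnion (Finset.mem_coe.2 (Finset.mem_filter.2 ⟨Finset.mem_univ f, hf⟩)) hlt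
  refine (measure_mono hsub).trans ((measure_biUnion_finset_le _ _).trans ?_)
  calc ∑ f ∈ T, P _ ≤ ∑ f ∈ T, ENNReal.ofReal (Real.exp (-(p / 4 * n))) := by
        refine Finset.sum_le_sum fun f hf => ?_
        refine pi_card_lt_le (S := fun _ y => 1 / 16 ≤ (gridPoint N f ⬝ᵥ y) ^ 2) (fun _ => ?_)
          Finset.univ hp (fun _ _ => h _ (Finset.mem_filter.1 hf).2) (by simp)
        exact measurableSet_le measurable_const
          ((measurable_dotProduct_const _).pow_const 2)
    _ = ENNReal.ofReal (T.card * Real.exp (-(p / 4 * n))) := by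
        rw [Finset.sum_const, nsmul_eq_mul, ENNReal.ofReal_mul (by positivity),
          ENNReal.ofReal_natCast]
    _ ≤ _ := by
        refine ENNReal.ofReal_le_ofReal ?_
        gcongr
        have : T.card ≤ (2 * N + 1) ^ d := by
          refine (Finset.card_le_univ _).trans_eq ?_
          simp
        exact_mod_cast this

/-! ### The good event has high probability -/

theorem measure_not_forall_le {Ω ι : Type*} [MeasurableSpace Ω] [Fintype ι] {P : Measure Ω}
    {S : ι → Ω → Prop} {q : ℝ} (h : ∀ i, P {ω | ¬ S i ω} ≤ ENNReal.ofReal q) :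
    P {ω | ¬ ∀ i, S i ω} ≤ ENNReal.ofReal (Fintype.card ι * q) := by
  have : {ω | ¬ ∀ i, S i ω} = ⋃ i, {ω | ¬ S i ω} := by ext; simp
  rw [this]
  refine (measure_iUnion_fintype_le P _).trans ((Finset.sum_le_sum fun i _ => h i).trans_eq ?_)
  rw [Finset.sum_const, nsmul_eq_mul, ENNReal.ofReal_mul (by positivity), ENNReal.ofReal_natCast,
    Finset.card_univ]

theorem measure_not_and_le {Ω : Type*} [MeasurableSpace Ω] {P : Measure Ω} {A B : Ω → Prop}
    {a b : ℝ} (ha : 0 ≤ a) (hb : 0 ≤ b) (hA : P {ω | ¬ A ω} ≤ ENNReal.ofReal a)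
    (hB : P {ω | ¬ B ω} ≤ ENNReal.ofReal b) :
    P {ω | ¬ (A ω ∧ B ω)} ≤ ENNReal.ofReal (a + b) := by
  have : {ω | ¬ (A ω ∧ B ω)} ⊆ {ω | ¬ A ω} ∪ {ω | ¬ B ω} := by
    intro ω hω
    have hω' : ¬ (A ω ∧ B ω) := hω
    by_cases h : A ω
    · exact Or.inr fun hb => hω' ⟨h, hb⟩
    · exact Or.inl h
  rw [ENNReal.ofReal_add ha hb]
  exact (measure_mono this).trans ((measure_union_le _ _).trans (add_le_add hA hB))

theorem measurable_card_filter {Ω ι : Type*} [MeasurableSpace Ω] [Fintype ι] {S : ι → Ω → Prop}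
    [∀ i ω, Decidable (S i ω)] (h : ∀ i, MeasurableSet {ω | S i ω}) :
    Measurable fun ω => ((Finset.univ.filter fun i => S i ω).card : ℝ) := by
  have : ∀ ω, ((Finset.univ.filter fun i => S i ω).card : ℝ) =
      ∑ i, {ω | S i ω}.indicator (1 : Ω → ℝ) ω := by
    intro ω
    rw [Finset.card_filter]
    push_cast
    refine Finset.sum_congr rfl fun i _ => ?_
    by_cases hi : S i ω <;> simp [hi]
  simp only [this]
  exact Finset.measurable_sum _ fun i _ => measurable_one.indicator (h i)

/-- According to the sign of `z`, it suffices that `y ≥ 1/2` or `y ≤ -1/2`. -/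
theorem exists_gaussian_tail_lower :
    ∃ p : ℝ, 0 < p ∧ ∀ θ z : ℝ, 0 < θ → θ ≤ |z| →
      p ≤ (gaussianReal 0 1).real {y | θ / 2 ≤ z * y} := by
  have hpos : ∀ s : Set ℝ, volume s ≠ 0 → 0 < (gaussianReal 0 1).real s := fun s hs => by
    refine ENNReal.toReal_pos (fun h0 => hs ?_) (measure_ne_top _ _)
    exact gaussianReal_absolutelyContinuous' 0 one_ne_zero h0
  have h1 := hpos (Set.Ici (1 / 2)) (by simp)
  have h2 := hpos (Set.Iic (-(1 / 2))) (by simp)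
  refine ⟨min _ _, lt_min h1 h2, fun θ z hθ hz => ?_⟩
  rcases le_abs'.1 hz with h | h
  · refine (min_le_right _ _).trans (measureReal_mono fun y hy => ?_)
    have hy' : y ≤ -(1 / 2) := hy
    change θ / 2 ≤ z * y
    nlinarith
  · refine (min_le_left _ _).trans (measureReal_mono fun y hy => ?_)
    have hy' : 1 / 2 ≤ y := hy
    change θ / 2 ≤ z * y
    nlinarith

/-- The event on the design on which leverages, influences and the second moment are controlled. -/
def GoodDesign {n d : ℕ} (t m : ℝ) (N : ℕ) (e : Fin d → ℝ) (x : Fin n → Fin d → ℝ) : Prop :=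
  (∀ ij : Fin n × Fin d, |x ij.1 ij.2| ≤ t) ∧
  (∀ i, |x i ⬝ᵥ e| ≤ t * √(e ⬝ᵥ e)) ∧
  (∀ ij : Fin n × Fin n, ij.2 ≠ ij.1 → |x ij.1 ⬝ᵥ (loo x ij.1)⁻¹ *ᵥ x ij.2| ≤
    t * √(((loo x ij.1)⁻¹ *ᵥ x ij.2) ⬝ᵥ ((loo x ij.1)⁻¹ *ᵥ x ij.2))) ∧
  (∀ i, |x i ⬝ᵥ (loo x i)⁻¹ *ᵥ e| ≤ t * √(((loo x i)⁻¹ *ᵥ e) ⬝ᵥ ((loo x i)⁻¹ *ᵥ e))) ∧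
  ∀ f : Fin d → Fin (2 * N + 1), 1 / 4 ≤ gridPoint N f ⬝ᵥ gridPoint N f → m ≤
    ((Finset.univ.filter fun i => 1 / 16 ≤ (gridPoint N f ⬝ᵥ x i) ^ 2).card : ℝ)

theorem IsotropicTail.goodDesign {n d N : ℕ} {C c t₀ : ℝ} {ν : Measure (Fin d → ℝ)}
    (h : IsotropicTail C c t₀ ν) {t p q : ℝ} (ht : t₀ ≤ t) (hp : 0 ≤ p)
    (hball : ∀ v : Fin d → ℝ, 1 / 4 ≤ v ⬝ᵥ v → p ≤ ν.real {x | 1 / 16 ≤ (v ⬝ᵥ x) ^ 2})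
    (hq : Real.exp (-(c * t ^ C)) ≤ q) (e : Fin d → ℝ) :
    Measure.pi (fun _ : Fin n => ν) {x | ¬ GoodDesign t (p / 4 * n) N e x} ≤
      ENNReal.ofReal (n * d * q + (n * q + (n * n * q + (n * q +
        (2 * N + 1) ^ d * Real.exp (-(p / 4 * n)))))) := by
  have := h.isProbability
  have hq0 : 0 ≤ q := (Real.exp_pos _).le.trans hq
  have key : ∀ (i : Fin n) (f : (Fin n → Fin d → ℝ) → Fin d → ℝ), Measurable f →
      (∀ x y, f (Function.update x i y) = f x) →
      Measure.pi (fun _ : Fin n => ν) {x | ¬ |x i ⬝ᵥ f x| ≤ t * √(f x ⬝ᵥ f x)} ≤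
        ENNReal.ofReal q := fun i f hf hinv => by
    simp only [not_le]
    exact (h.pi_tail_of_invariant i hf hinv ht).trans (ENNReal.ofReal_le_ofReal hq)
  have hloo : ∀ (i : Fin n) (g : (Fin n → Fin d → ℝ) → Fin d → ℝ), Measurable g →
      Measurable fun x => (loo x i)⁻¹ *ᵥ g x := fun i g hg =>
    measurable_mulVec (measurable_inv_apply (measurable_loo_apply i)) hg
  refine measure_not_and_le (by positivity) (by positivity) ?_
    (measure_not_and_le (by positivity) (by positivity) ?_
    (measure_not_and_le (by positivity) (by positivity) ?_
    (measure_not_and_le (by positivity) (by positivity) ?_ (pi_grid_le hp hball))))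
  · have := measure_not_forall_le (P := Measure.pi (fun _ : Fin n => ν))
      (S := fun (ij : Fin n × Fin d) (x : Fin n → Fin d → ℝ) => |x ij.1 ij.2| ≤ t) (q := q)
      fun ij => by
        simpa using key ij.1 (fun _ => Pi.single ij.2 1) measurable_const fun _ _ => rfl
    simpa using this
  · have := measure_not_forall_le (P := Measure.pi (fun _ : Fin n => ν)) (q := q)
      fun i => key i (fun _ => e) measurable_const fun _ _ => rfl
    simpa using this
  · have := measure_not_forall_le (P := Measure.pi (fun _ : Fin n => ν)) (q := q)
      (S := fun (ij : Fin n × Fin n) (x : Fin n → Fin d → ℝ) => ij.2 ≠ ij.1 →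
        |x ij.1 ⬝ᵥ (loo x ij.1)⁻¹ *ᵥ x ij.2| ≤
        t * √(((loo x ij.1)⁻¹ *ᵥ x ij.2) ⬝ᵥ ((loo x ij.1)⁻¹ *ᵥ x ij.2)))
      fun ij => by
        by_cases hij : ij.2 = ij.1
        -- The diagonal pair must be excluded: there the vector would depend on row `i` itself.
        · simp [hij]
        · refine le_trans (measure_mono ?_) (key ij.1 (fun x => (loo x ij.1)⁻¹ *ᵥ x ij.2)
            (hloo _ _ (measurable_pi_apply _)) fun x y => ?_)
          · intro x hx hx'
            exact hx fun _ => hx'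
          · rw [loo_update, Function.update_of_ne hij]
    simpa using this
  · have := measure_not_forall_le (P := Measure.pi (fun _ : Fin n => ν)) (q := q)
      fun i => key i (fun x => (loo x i)⁻¹ *ᵥ e) (hloo _ _ measurable_const) fun x y => by
        rw [loo_update]
    simpa using this

/-- The event on the noise, given the design. -/
def GoodNoise {n d : ℕ} (t θ m c : ℝ) (e : Fin d → ℝ) (x : Fin n → Fin d → ℝ) (ζ : Fin n → ℝ) :
    Prop :=
  (∀ i, |ζ i| ≤ t) ∧
  (∀ i, |(hat (Matrix.of x) *ᵥ ζ) i| ≤ t * √(∑ j, hat (Matrix.of x) i j ^ 2)) ∧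
  (m ≤ ((Finset.univ.filter fun i => θ ≤ |infl (Matrix.of x) e i|).card : ℝ) →
    c * m ≤ ((Finset.univ.filter fun i => θ / 2 ≤ infl (Matrix.of x) e i * ζ i).card : ℝ))

/-- Everything is proved for each fixed design. The count is stated as an implication so that it
holds with high probability even for designs with few large influences, where it is vacuous. -/
theorem goodNoise {n d : ℕ} (μ : Measure (Fin d → ℝ)) [IsProbabilityMeasure μ]
    {t θ m p q : ℝ} (ht : 0 ≤ t) (hθ : 0 < θ) (hp : 0 ≤ p)
    (hg : ∀ θ z : ℝ, 0 < θ → θ ≤ |z| → p ≤ (gaussianReal 0 1).real {y | θ / 2 ≤ z * y})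
    (hq : Real.exp (-(t ^ 2 / 2)) ≤ q) (e : Fin d → ℝ) :
    designNoiseLaw μ n {ω | ¬ GoodNoise t θ m (p / 4) e ω.1 ω.2} ≤
      ENNReal.ofReal (n * (2 * q) + (n * (2 * q) + Real.exp (-(p / 4 * m)))) := by
  have hq0 : 0 ≤ q := (Real.exp_pos _).le.trans hq
  have key : ∀ a : (Fin n → Fin d → ℝ) → Fin n → ℝ, (∀ j, Measurable fun x => a x j) →
      designNoiseLaw μ n {ω | ¬ |∑ j, a ω.1 j * ω.2 j| ≤ t * √(∑ j, a ω.1 j ^ 2)} ≤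
        ENNReal.ofReal (2 * q) := fun a ha => by
    simp only [not_le]
    refine prod_le_of_section ?_ fun x => ?_
    · exact measurableSet_lt
        ((Finset.measurable_sum _ fun j _ =>
          ((ha j).comp measurable_fst).pow_const 2).sqrt.const_mul t)
        (Finset.measurable_sum _ fun j _ => ((ha j).comp measurable_fst).mul
          ((measurable_pi_apply j).comp measurable_snd)).abs
    · refine (pi_gaussian_abs_gt_le (a x) ht).trans (ENNReal.ofReal_le_ofReal ?_)
      linarith
  refine measure_not_and_le (by positivity) (by positivity) ?_
    (measure_not_and_le (by positivity) (by positivity) ?_ ?_)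
  · have := measure_not_forall_le (P := designNoiseLaw μ n)
      (S := fun (i : Fin n) (ω : (Fin n → Fin d → ℝ) × (Fin n → ℝ)) => |ω.2 i| ≤ t) (q := 2 * q)
      fun i => by
        have := key (fun _ => Pi.single i 1) fun _ => measurable_const
        simpa [Pi.single_apply, ite_pow] using this
    simpa using this
  · have := measure_not_forall_le (P := designNoiseLaw μ n) (q := 2 * q)
      fun i => key (fun x j => hat (Matrix.of x) i j) fun j => measurable_hat_apply i j
    rw [Fintype.card_fin] at this
    exact this
  · have hZ : ∀ i, Measurable fun ω : (Fin n → Fin d → ℝ) × (Fin n → ℝ) =>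
        infl (Matrix.of ω.1) e i := fun i => (measurable_infl_apply e i).comp measurable_fst
    have hm1 := measurable_card_filter
      (S := fun i (ω : (Fin n → Fin d → ℝ) × (Fin n → ℝ)) => θ ≤ |infl (Matrix.of ω.1) e i|)
      fun i => measurableSet_le measurable_const (hZ i).abs
    have hm2 := measurable_card_filter
      (S := fun i (ω : (Fin n → Fin d → ℝ) × (Fin n → ℝ)) =>
        θ / 2 ≤ infl (Matrix.of ω.1) e i * ω.2 i)
      fun i => measurableSet_le measurable_const
        ((hZ i).mul ((measurable_pi_apply i).comp measurable_snd))
    simp only [Classical.not_imp, not_le]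
    refine prod_le_of_section
      ((measurableSet_le measurable_const hm1).inter (measurableSet_lt hm2 measurable_const))
      fun x => ?_
    by_cases hx : m ≤ ((Finset.univ.filter fun i => θ ≤ |infl (Matrix.of x) e i|).card : ℝ)
    · refine le_trans (measure_mono ?_) (pi_card_lt_le
        (S := fun i y => θ / 2 ≤ infl (Matrix.of x) e i * y)
        (fun i => measurableSet_le measurable_const (measurable_id.const_mul _))
        (Finset.univ.filter fun i => θ ≤ |infl (Matrix.of x) e i|) hp
        (fun i hi => hg θ _ hθ (Finset.mem_filter.1 hi).2) hx)
      exact fun ζ hζ => hζ.2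
    · refine le_trans (measure_mono (t := ∅) ?_) (by simp)
      exact fun ζ hζ => hx hζ.1

/-- ACRE succeeds on isotropic designs, with explicit parameters. -/
theorem IsotropicTail.acre {n d : ℕ} {C c t₀ : ℝ} {ν : Measure (Fin d → ℝ)}
    (h : IsotropicTail C c t₀ ν) {t l p q : ℝ} (hp : 0 < p)
    (hball : ∀ v : Fin d → ℝ, 1 / 4 ≤ v ⬝ᵥ v → p ≤ ν.real {x | 1 / 16 ≤ (v ⬝ᵥ x) ^ 2})
    (hg : ∀ θ z : ℝ, 0 < θ → θ ≤ |z| → p ≤ (gaussianReal 0 1).real {y | θ / 2 ≤ z * y})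
    (ht₀ : t₀ ≤ t) (ht : 1 ≤ t) (hl : 1 ≤ l) (hn : 1 ≤ n) (hdn : d ≤ n)
    {e : Fin d → ℝ} (he : 0 < e ⬝ᵥ e) (hpl : 512 ≤ p * l) (hpn : 8 ≤ p * n)
    (htn : 8 * d * t ≤ n ^ 2) (hd1 : 64 * t ^ 8 * l ^ 3 * d ≤ n)
    (hq1 : Real.exp (-(c * t ^ C)) ≤ q) (hq2 : Real.exp (-(t ^ 2 / 2)) ≤ q)
    (hq3 : (2 * n ^ 2 + 1) ^ d * Real.exp (-(p / 4 * n)) ≤ q)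
    (hq4 : Real.exp (-(p / 4 * (n / (2 * t ^ 4 * l ^ 2)))) ≤ q) :
    designNoiseLaw ν n {ω | ¬ (((Matrix.of ω.1)ᵀ * Matrix.of ω.1).PosDef ∧
      ∀ k : ℕ, 1 ≤ k → k * (t ^ 4 * l ^ 3) ≤ n →
      8 * t ^ 4 * l ^ 2 * (k * d ^ 2) ≤ n ^ 2 → 8 * t ^ 4 * l ^ 2 * (k ^ 2 * d) ≤ n ^ 2 →
      64 * t ^ 5 * l ^ 2 * (d + k * √d) ≤ n →
      let G := hat (Matrix.of ω.1)
      let R := ω.2 - G *ᵥ ω.2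
      let Z := infl (Matrix.of ω.1) e
      let A := cumSum (sortDesc fun i => R i * Z i) k
      let B := 1 / (1 - rti (G.map (fun g => g ^ 2)) k)
        * rti (Matrix.diagonal R * G * Matrix.diagonal R) k
        * rti (Matrix.diagonal Z * G * Matrix.diagonal Z) k
      0 < A - B ∧ 1 ≤ (A + B) / (A - B) ∧
        (A + B) / (A - B) ≤ 1 + 128 * t ^ 5 * l ^ 2 * ((d + k * √d) / n))} ≤
      ENNReal.ofReal (10 * n ^ 2 * q) := by
  have := h.isProbability
  have hn0 : (0 : ℝ) < n := by exact_mod_cast hn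
  have hn1 : (1 : ℝ) ≤ n := by exact_mod_cast hn
  have hdn' : (d : ℝ) ≤ n := by exact_mod_cast hdn
  have hl0 : 0 < l := by linarith
  have ht0 : 0 < t := by linarith
  have hq0 : 0 ≤ q := (Real.exp_pos _).le.trans hq1
  have hD := (prod_fst_eq (Measure.pi fun _ : Fin n => ν)
    (Measure.pi fun _ : Fin n => gaussianReal 0 1) _).trans_le
    (h.goodDesign (n := n) (N := n ^ 2) ht₀ hp.le hball hq1 e)
  have hθ : 0 < √(e ⬝ᵥ e) / n / (2 * t) := by positivity
  have hN := goodNoise (n := n) (d := d) ν (m := n / (2 * t ^ 4 * l ^ 2)) ht0.le hθ hp.le hg hq2 e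
  have hboth := measure_not_and_le (P := designNoiseLaw ν n)
    (A := fun ω => GoodDesign t (p / 4 * n) (n ^ 2) e ω.1) (by positivity) (by positivity) hD hN
  refine (measure_mono ?_).trans (hboth.trans (ENNReal.ofReal_le_ofReal ?_))
  · rintro ⟨x, ζ⟩ hω ⟨⟨hx, hxe, hxx, hxi, hgrid⟩, hζ, hGζ, hcount⟩
    refine hω ?_
    have hκ : ∀ i v, n / l * (v ⬝ᵥ v) ≤ v ⬝ᵥ loo x i *ᵥ v := fun i v => by
      refine le_trans ?_ (coercive_of_grid (x := x) (t := t) (m := p / 4 * n) (N := n ^ 2)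
        (Nat.one_le_pow _ _ hn) (fun i j => hx (i, j)) ht (by push_cast; exact htn) hgrid i v)
      have := dotProduct_self_nonneg' v
      refine mul_le_mul_of_nonneg_right ?_ this
      -- The grid gives curvature `(p n / 4 - 1) / 64`, which is at least `p n / 512` once `p n ≥
      -- 8`.
      have h1 : n / l ≤ p * n / 512 := by
        rw [div_le_div_iff₀ hl0 (by norm_num)]
        nlinarith
      linarith
    refine ⟨posDef_of_coercive transpose_gram (by positivity : 0 < n / l)
      (coercive_gram ⟨0, hn⟩ (hκ _)), fun k hk hk1 hkd hkd' hkd1 => ?_⟩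
    exact acre_on_good_event hn ht hl he hκ (fun i j => hx (i, j)) hxe
      (fun i j hji => hxx (i, j) hji) hxi hζ hGζ hcount hk (by linarith) hk1 hd1 hkd hkd' hkd1
  · have e1 : n * d * q ≤ n ^ 2 * q := by rw [sq]; gcongr
    have e2 : n * q ≤ n ^ 2 * q := by rw [sq]; gcongr; nlinarith
    have e3 : q ≤ n ^ 2 * q := le_mul_of_one_le_left hq0 (one_le_pow₀ hn1)
    push_cast
    linarith

/-! ### Reduction to isotropic designs -/

theorem integral_dotProduct_sq {d : ℕ} {μ : Measure (Fin d → ℝ)}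
    (h : ∀ j, MemLp (fun x : Fin d → ℝ => x j) 2 μ) (u : Fin d → ℝ) :
    Integrable (fun x => (u ⬝ᵥ x) ^ 2) μ ∧
      ∫ x, (u ⬝ᵥ x) ^ 2 ∂μ = u ⬝ᵥ secondMoment μ *ᵥ u := by
  have hij : ∀ i j, Integrable (fun x : Fin d → ℝ => x i * x j) μ := fun i j =>
    (h i).integrable_mul (h j)
  have hexp : ∀ x : Fin d → ℝ, (u ⬝ᵥ x) ^ 2 = ∑ i, ∑ j, u i * (u j * (x i * x j)) := fun x => by
    rw [sq, dotProduct, Finset.sum_mul_sum]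
    refine Finset.sum_congr rfl fun i _ => Finset.sum_congr rfl fun j _ => ?_
    ring
  simp only [hexp]
  have hint : ∀ i j, Integrable (fun x : Fin d → ℝ => u i * (u j * (x i * x j))) μ := fun i j =>
    ((hij i j).const_mul _).const_mul _
  refine ⟨integrable_finsetSum _ fun i _ => integrable_finsetSum _ fun j _ => hint i j, ?_⟩
  rw [integral_finsetSum _ fun i _ => integrable_finsetSum _ fun j _ => hint i j, dotProduct]
  refine Finset.sum_congr rfl fun i _ => ?_
  rw [integral_finsetSum _ fun j _ => hint i j, Matrix.mulVec, dotProduct, Finset.mul_sum]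
  refine Finset.sum_congr rfl fun j _ => ?_
  rw [integral_const_mul, integral_const_mul, secondMoment, Matrix.of_apply]
  ring

/-- `Σ^{-1/2}`. -/
noncomputable def whitening {d : ℕ} (μ : Measure (Fin d → ℝ)) : Matrix (Fin d) (Fin d) ℝ :=
  (CFC.sqrt (secondMoment μ))⁻¹

theorem transpose_whitening {d : ℕ} (μ : Measure (Fin d → ℝ)) :
    (whitening μ)ᵀ = whitening μ := by
  rw [whitening, Matrix.transpose_nonsing_inv, transpose_sqrt]

theorem measurable_whitening {d : ℕ} (μ : Measure (Fin d → ℝ)) :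
    Measurable fun x : Fin d → ℝ => whitening μ *ᵥ x :=
  measurable_mulVec (fun _ _ => measurable_const) measurable_id

namespace WellBehaved

variable {d : ℕ} {C c t₀ : ℝ} {μ : Measure (Fin d → ℝ)}

theorem isUnit_det_whitening (h : WellBehaved C c t₀ μ) : IsUnit (whitening μ).det :=
  Matrix.isUnit_nonsing_inv_det _ (isUnit_det_sqrt h.posDef)

theorem isotropicTail (h : WellBehaved C c t₀ μ) :
    IsotropicTail C c t₀ (μ.map fun x => whitening μ *ᵥ x) := by
  have := h.isProbability
  have hm := measurable_whitening μ
  have hdot : ∀ v x : Fin d → ℝ, v ⬝ᵥ whitening μ *ᵥ x = (whitening μ *ᵥ v) ⬝ᵥ x := fun v x => by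
    rw [Matrix.dotProduct_mulVec, ← Matrix.mulVec_transpose, transpose_whitening]
  have hsm : ∀ v : Fin d → ℝ, AEStronglyMeasurable (fun x => (v ⬝ᵥ x) ^ 2)
      (μ.map fun x => whitening μ *ᵥ x) := fun v =>
    ((measurable_dotProduct_const v).pow_const 2).aestronglyMeasurable
  refine ⟨Measure.isProbabilityMeasure_map hm.aemeasurable, fun v => ?_, fun v => ?_,
    fun v hv t ht => ?_⟩
  · rw [integrable_map_measure (hsm v) hm.aemeasurable]
    simp only [Function.comp_def, hdot]
    exact (integral_dotProduct_sq h.memLp_two _).1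
  · rw [integral_map hm.aemeasurable (hsm v)]
    simp only [hdot]
    rw [(integral_dotProduct_sq h.memLp_two _).2, ← hdot, Matrix.mulVec_mulVec,
      Matrix.mulVec_mulVec, whitening, inv_sqrt_mul_mul_inv_sqrt h.posDef,
      Matrix.one_mulVec]
  · rw [Measure.map_apply hm
      (measurableSet_lt measurable_const (measurable_dotProduct_const v).abs)]
    exact h.tail v hv t ht

theorem map_designNoiseLaw (h : WellBehaved C c t₀ μ) (n : ℕ) :
    (designNoiseLaw μ n).map (fun ω => (fun i => whitening μ *ᵥ ω.1 i, ω.2)) =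
      designNoiseLaw (μ.map fun x => whitening μ *ᵥ x) n := by
  have := h.isProbability
  have hm := measurable_whitening μ
  have := Measure.isProbabilityMeasure_map hm.aemeasurable (μ := μ)
  have hm' : Measurable fun x : Fin n → Fin d → ℝ => fun i => whitening μ *ᵥ x i :=
    measurable_pi_lambda _ fun i => hm.comp (measurable_pi_apply i)
  have h1 := Measure.pi_map_pi (μ := fun _ : Fin n => μ)
    (f := fun _ : Fin n => fun x => whitening μ *ᵥ x) fun _ => hm.aemeasurable
  have h2 := Measure.map_prod_map (Measure.pi fun _ : Fin n => μ)
    (Measure.pi fun _ : Fin n => gaussianReal 0 1) hm' measurable_id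
  rw [Measure.map_id] at h2
  rw [designNoiseLaw, designNoiseLaw, ← h1, h2]
  rfl

end WellBehaved

theorem posDef_gram_of_mul {n d : ℕ} {X : Matrix (Fin n) (Fin d) ℝ}
    {S : Matrix (Fin d) (Fin d) ℝ} (hX : ((X * S)ᵀ * (X * S)).PosDef) : (Xᵀ * X).PosDef := by
  have hpsd := Matrix.posSemidef_conjTranspose_mul_self X
  rw [Matrix.conjTranspose_eq_transpose_of_trivial] at hpsd
  rw [hpsd.posDef_iff_isUnit, Matrix.isUnit_iff_isUnit_det]
  have h : IsUnit ((X * S)ᵀ * (X * S)).det := hX.det_pos.ne'.isUnit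
  rw [show (X * S)ᵀ * (X * S) = Sᵀ * (Xᵀ * X) * S by
    simp only [Matrix.transpose_mul, Matrix.mul_assoc], Matrix.det_mul, Matrix.det_mul] at h
  exact isUnit_of_mul_isUnit_right (isUnit_of_mul_isUnit_left h)

theorem of_mulVec_eq {n d : ℕ} (S : Matrix (Fin d) (Fin d) ℝ) (x : Fin n → Fin d → ℝ) :
    Matrix.of (fun i => S *ᵥ x i) = Matrix.of x * Sᵀ := by
  ext i j
  simp [Matrix.mul_apply, Matrix.mulVec, dotProduct, mul_comm]

/-- ACRE succeeds on well-behaved designs, with explicit parameters. -/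
theorem WellBehaved.acre {n d : ℕ} {C c t₀ : ℝ} {μ : Measure (Fin d → ℝ)}
    (h : WellBehaved C c t₀ μ) {t l p q : ℝ} (hp : 0 < p)
    (hball : ∀ {ν : Measure (Fin d → ℝ)}, IsotropicTail C c t₀ ν →
      ∀ v : Fin d → ℝ, 1 / 4 ≤ v ⬝ᵥ v → p ≤ ν.real {x | 1 / 16 ≤ (v ⬝ᵥ x) ^ 2})
    (hg : ∀ θ z : ℝ, 0 < θ → θ ≤ |z| → p ≤ (gaussianReal 0 1).real {y | θ / 2 ≤ z * y})
    (ht₀ : t₀ ≤ t) (ht : 1 ≤ t) (hl : 1 ≤ l) (hn : 1 ≤ n) (hdn : d ≤ n)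
    (β : Fin d → ℝ) {e : Fin d → ℝ} (he : e ⬝ᵥ e = 1) (hpl : 512 ≤ p * l) (hpn : 8 ≤ p * n)
    (htn : 8 * d * t ≤ n ^ 2) (hd1 : 64 * t ^ 8 * l ^ 3 * d ≤ n)
    (hq1 : Real.exp (-(c * t ^ C)) ≤ q) (hq2 : Real.exp (-(t ^ 2 / 2)) ≤ q)
    (hq3 : (2 * n ^ 2 + 1) ^ d * Real.exp (-(p / 4 * n)) ≤ q)
    (hq4 : Real.exp (-(p / 4 * (n / (2 * t ^ 4 * l ^ 2)))) ≤ q) :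
    designNoiseLaw μ n {ω | ¬ ∀ k : ℕ, 1 ≤ k → k * (t ^ 4 * l ^ 3) ≤ n →
      8 * t ^ 4 * l ^ 2 * (k * d ^ 2) ≤ n ^ 2 → 8 * t ^ 4 * l ^ 2 * (k ^ 2 * d) ≤ n ^ 2 →
      64 * t ^ 5 * l ^ 2 * (d + k * √d) ≤ n →
      let X : Matrix (Fin n) (Fin d) ℝ := Matrix.of ω.1
      let Y : Fin n → ℝ := X *ᵥ β + ω.2
      let U : ℝ := acreUpper X Y e k
      let L : ℝ := acreLower X Y e k
      0 < L ∧ 1 ≤ U / L ∧ U / L ≤ 1 + 128 * t ^ 5 * l ^ 2 * ((d + k * √d) / n)} ≤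
      ENNReal.ofReal (10 * n ^ 2 * q) := by
  have := h.isProbability
  have hS := h.isUnit_det_whitening
  set S := whitening μ with hSdef
  -- Whitening destroys the unit length of `e`; the isotropic statement needs only a nonzero vector,
  -- since the ratio of the bounds is scale invariant in `e`.
  have he' : 0 < (Sᵀ *ᵥ e) ⬝ᵥ (Sᵀ *ᵥ e) := by
    refine lt_of_le_of_ne (dotProduct_self_nonneg' _) fun h0 => ?_
    have h1 : Sᵀ *ᵥ e = 0 := dotProduct_self_eq_zero.1 h0.symm
    have h2 : (Sᵀ)⁻¹ *ᵥ (Sᵀ *ᵥ e) = e := by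
      rw [Matrix.mulVec_mulVec, Matrix.nonsing_inv_mul _ (by rwa [Matrix.det_transpose]),
        Matrix.one_mulVec]
    rw [h1, Matrix.mulVec_zero] at h2
    rw [← h2] at he
    simp at he
  have hm : Measurable fun ω : (Fin n → Fin d → ℝ) × (Fin n → ℝ) =>
      ((fun i => S *ᵥ ω.1 i, ω.2) : (Fin n → Fin d → ℝ) × (Fin n → ℝ)) :=
    (measurable_pi_lambda _ fun i => (measurable_whitening μ).comp
      ((measurable_pi_apply i).comp measurable_fst)).prodMk measurable_snd
  have main := h.isotropicTail.acre hp (hball h.isotropicTail) hg ht₀ ht hl hn hdn he' hpl hpn htn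
    hd1 hq1 hq2 hq3 hq4
  rw [← h.map_designNoiseLaw] at main
  -- This inequality needs measurability of the map only, not of the failure event.
  refine le_trans (measure_mono ?_) ((Measure.le_map_apply hm.aemeasurable _).trans main)
  rintro ⟨x, ζ⟩ hω hgood
  refine hω ?_
  obtain ⟨hpd, hgood⟩ := hgood
  have hW : Matrix.of (fun i => S *ᵥ x i) = Matrix.of x * S := by
    rw [of_mulVec_eq, hSdef, transpose_whitening]
  intro k hk hk1 hk2 hk3 hk4
  have hfin := hgood k hk hk1 hk2 hk3 hk4
  change ((Matrix.of (fun i => S *ᵥ x i))ᵀ * Matrix.of (fun i => S *ᵥ x i)).PosDef at hpd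
  simp only at hfin
  rw [hW] at hpd hfin
  have hX := posDef_gram_of_mul hpd
  rw [hat_mul_right _ hS, infl_mul_right _ hS] at hfin
  simp only [acreUpper, acreLower, acreFirstOrder, acreErrorTerm, normalized_mul_transpose hX,
    normalized_mulVec hX, normalized_residual hX]
  exact hfin

/-! ### Choice of parameters -/

/-- Since `k ≥ 1`, being below the threshold already forces `d² ≪ n²`; this is the third bound. -/
theorem threshold_facts {n d k B : ℕ} {l : ℝ} (hd : 1 ≤ d) (hl : 1 ≤ l) (hk : 1 ≤ k)
    (h : (k : ℝ) < min ((n : ℝ) / √(d : ℝ)) ((n : ℝ) ^ 2 / (d : ℝ) ^ 2) / (2 * l) ^ (2 * B)) :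
    k * √d * l ^ (2 * B) ≤ n ∧ k * d ^ 2 * l ^ (2 * B) ≤ n ^ 2 ∧ d * l ^ B ≤ n := by
  have hd0 : (0 : ℝ) < d := by exact_mod_cast hd
  have hk1 : (1 : ℝ) ≤ k := by exact_mod_cast hk
  have hl0 : 0 < l := by linarith
  rw [lt_div_iff₀ (by positivity), lt_min_iff, lt_div_iff₀ (by positivity),
    lt_div_iff₀ (by positivity)] at h
  have hl2 : l ^ (2 * B) ≤ (2 * l) ^ (2 * B) := by
    gcongr
    linarith
  have h1 : k * √d * l ^ (2 * B) ≤ n := by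
    calc k * √d * l ^ (2 * B) ≤ k * √d * (2 * l) ^ (2 * B) := by gcongr
      _ = k * (2 * l) ^ (2 * B) * √d := by ring
      _ ≤ n := h.1.le
  have h2 : k * d ^ 2 * l ^ (2 * B) ≤ (n : ℝ) ^ 2 := by
    calc k * d ^ 2 * l ^ (2 * B) ≤ k * d ^ 2 * (2 * l) ^ (2 * B) := by gcongr
      _ = k * (2 * l) ^ (2 * B) * d ^ 2 := by ring
      _ ≤ (n : ℝ) ^ 2 := h.2.le
  refine ⟨h1, h2, ?_⟩
  refine le_of_sq_le_sq ?_ (by positivity)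
  calc (d * l ^ B) ^ 2 = 1 * d ^ 2 * l ^ (2 * B) := by ring
    _ ≤ k * d ^ 2 * l ^ (2 * B) := by gcongr
    _ ≤ _ := h2

/-- The side conditions on `k` and `d` hold below the threshold. -/
theorem side_conditions {n d k α : ℕ} {l : ℝ} (hd : 1 ≤ d) (hl : 128 ≤ l)
    (h1 : k * √d * l ^ (2 * (8 * α + 5)) ≤ n) (h2 : k * d ^ 2 * l ^ (2 * (8 * α + 5)) ≤ (n : ℝ) ^ 2)
    (h3 : d * l ^ (8 * α + 5) ≤ n) :
    k * ((l ^ α) ^ 4 * l ^ 3) ≤ n ∧ 8 * (l ^ α) ^ 4 * l ^ 2 * (k * d ^ 2) ≤ (n : ℝ) ^ 2 ∧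
      8 * (l ^ α) ^ 4 * l ^ 2 * (k ^ 2 * d) ≤ (n : ℝ) ^ 2 ∧
      64 * (l ^ α) ^ 5 * l ^ 2 * (d + k * √d) ≤ n ∧
      64 * (l ^ α) ^ 8 * l ^ 3 * d ≤ n := by
  have hl0 : 0 < l := by linarith
  have hl1 : 1 ≤ l := by linarith
  have hd1 : (1 : ℝ) ≤ d := by exact_mod_cast hd
  have hsd : 1 ≤ √(d : ℝ) := Real.one_le_sqrt.2 hd1
  have mono : ∀ {a b : ℕ}, a ≤ b → l ^ a ≤ l ^ b := fun hab => pow_le_pow_right₀ hl1 hab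
  have mono' : ∀ {a b : ℕ}, a + 1 ≤ b → 128 * l ^ a ≤ l ^ b := fun {a b} hab => by
    calc 128 * l ^ a ≤ l * l ^ a := by gcongr
      _ = l ^ (a + 1) := by ring
      _ ≤ _ := mono hab
  have hpos : ∀ a : ℕ, 0 ≤ l ^ a := fun a => by positivity
  refine ⟨?_, ?_, ?_, ?_, ?_⟩
  · refine le_trans ?_ h1
    calc k * ((l ^ α) ^ 4 * l ^ 3) = k * 1 * l ^ (4 * α + 3) := by ring
      _ ≤ k * √d * l ^ (2 * (8 * α + 5)) := by
        gcongr
        omega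
  · refine le_trans ?_ h2
    calc 8 * (l ^ α) ^ 4 * l ^ 2 * (k * d ^ 2) = k * d ^ 2 * (8 * l ^ (4 * α + 2)) := by ring
      _ ≤ k * d ^ 2 * l ^ (2 * (8 * α + 5)) := by
        gcongr
        linarith [mono' (show 4 * α + 2 + 1 ≤ 2 * (8 * α + 5) by omega), hpos (4 * α + 2)]
  · refine le_trans ?_ (pow_le_pow_left₀ (by positivity) h1 2)
    calc 8 * (l ^ α) ^ 4 * l ^ 2 * (k ^ 2 * d) = k ^ 2 * d * (8 * l ^ (4 * α + 2)) := by ring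
      _ ≤ k ^ 2 * d * l ^ (2 * (2 * (8 * α + 5))) := by
        gcongr
        linarith [mono' (show 4 * α + 2 + 1 ≤ 2 * (2 * (8 * α + 5)) by omega), hpos (4 * α + 2)]
      _ = (k * √d * l ^ (2 * (8 * α + 5))) ^ 2 := by
        rw [mul_pow, mul_pow, Real.sq_sqrt (by positivity)]; ring
  · have e1 : 128 * l ^ (5 * α + 2) * d ≤ n := by
      refine le_trans ?_ h3
      rw [mul_comm (d : ℝ)]
      gcongr
      exact mono' (by omega)
    have e2 : 128 * l ^ (5 * α + 2) * (k * √d) ≤ n := by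
      refine le_trans ?_ h1
      rw [mul_comm (k * √d : ℝ)]
      gcongr
      exact mono' (by omega)
    calc 64 * (l ^ α) ^ 5 * l ^ 2 * (d + k * √d)
        = (128 * l ^ (5 * α + 2) * d + 128 * l ^ (5 * α + 2) * (k * √d)) / 2 := by ring
      _ ≤ n := by linarith
  -- The most demanding condition on `d`: it dictates the exponent `8 * α + 5`.
  · refine le_trans ?_ h3
    calc 64 * (l ^ α) ^ 8 * l ^ 3 * d = d * (64 * l ^ (8 * α + 3)) := by ring
      _ ≤ d * l ^ (8 * α + 5) := by
        gcongr
        linarith [mono' (show 8 * α + 3 + 1 ≤ 8 * α + 5 by omega), hpos (8 * α + 3)]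

/-- With `t = l ^ α` one has `t ^ C ≥ l ^ 3`, and the spare factor `l` absorbs `c`. -/
theorem exp_tail_le {C c l : ℝ} {α : ℕ} (hα : 3 ≤ α * C) (hl : 1 ≤ l) (hcl : 1 ≤ c * l)
    (hc : 0 < c) : Real.exp (-(c * (l ^ α) ^ C)) ≤ Real.exp (-l ^ 2) := by
  apply Real.exp_le_exp.2
  have hl0 : 0 ≤ l := by linarith
  have h1 : l ^ 3 ≤ (l ^ α) ^ C := by
    rw [← Real.rpow_natCast l α, ← Real.rpow_mul hl0, ← Real.rpow_natCast l 3]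
    exact Real.rpow_le_rpow_of_exponent_le hl (by exact_mod_cast hα)
  have h2 : c * l ^ 3 ≤ c * (l ^ α) ^ C := by gcongr
  nlinarith [sq_nonneg l]

theorem exp_gaussian_le {l : ℝ} {α : ℕ} (hα : 2 ≤ α) (hl : 2 ≤ l) :
    Real.exp (-((l ^ α) ^ 2 / 2)) ≤ Real.exp (-l ^ 2) := by
  apply Real.exp_le_exp.2
  have h1 : l ^ 2 ≤ l ^ α := pow_le_pow_right₀ (by linarith) hα
  have h2 : (l ^ 2) ^ 2 ≤ (l ^ α) ^ 2 := by gcongr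
  have h3 : 4 ≤ l ^ 2 := by nlinarith
  nlinarith

/-- The net has at most `exp (3 d l)` points, and `3 d l ≤ p n / 8` leaves half of the Chernoff
exponent. -/
theorem exp_net_le {n d : ℕ} {p l : ℝ} (hn : 3 ≤ n) (hl : l = Real.log n) (hl1 : 1 ≤ l)
    (hpl : 24 ≤ p * l) (hd : d * l ^ 2 ≤ n) (hpn : 8 * l ^ 2 ≤ p * n) :
    (2 * (n : ℝ) ^ 2 + 1) ^ d * Real.exp (-(p / 4 * n)) ≤ Real.exp (-l ^ 2) := by
  have hn3 : (3 : ℝ) ≤ n := by exact_mod_cast hn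
  have hl0 : 0 < l := by linarith
  have h1 : 2 * (n : ℝ) ^ 2 + 1 ≤ Real.exp (3 * l) := by
    have : Real.exp (3 * l) = (n : ℝ) ^ 3 := by
      rw [show (3 : ℝ) * l = ((3 : ℕ) : ℝ) * l by norm_num, Real.exp_nat_mul, hl,
        Real.exp_log (by linarith)]
    rw [this]
    nlinarith
  calc (2 * (n : ℝ) ^ 2 + 1) ^ d * Real.exp (-(p / 4 * n))
      ≤ Real.exp (3 * l) ^ d * Real.exp (-(p / 4 * n)) := by gcongr
    _ = Real.exp (d * (3 * l) + -(p / 4 * n)) := by rw [← Real.exp_nat_mul, ← Real.exp_add]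
    _ ≤ _ := by
      apply Real.exp_le_exp.2
      have h2 : 24 * (d * l) ≤ p * n := by
        refine le_of_mul_le_mul_right ?_ hl0
        calc 24 * (d * l) * l = 24 * (d * l ^ 2) := by ring
          _ ≤ 24 * n := by gcongr
          _ ≤ p * l * n := by gcongr
          _ = _ := by ring
      linarith

theorem exp_count_le {n α : ℕ} {p l : ℝ} (hl : 1 ≤ l) (hpl : 8 ≤ p * l)
    (hn : l ^ (4 * α + 5) ≤ n) :
    Real.exp (-(p / 4 * (n / (2 * (l ^ α) ^ 4 * l ^ 2)))) ≤ Real.exp (-l ^ 2) := by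
  apply Real.exp_le_exp.2
  have hl0 : 0 < l := by linarith
  have hp : 0 ≤ p := by
    by_contra! h
    linarith [mul_neg_of_neg_of_pos h hl0]
  have : l ^ 2 ≤ p / 4 * (n / (2 * (l ^ α) ^ 4 * l ^ 2)) := by
    calc l ^ 2 = 8 / 8 * l ^ 2 := by ring
      _ ≤ p * l / 8 * l ^ 2 := by gcongr
      _ = p / 4 * (l ^ (4 * α + 5) / (2 * (l ^ α) ^ 4 * l ^ 2)) := by field_simp; ring
      _ ≤ _ := by gcongr
  linarith

theorem negligible_exp_log_sq (n₀ : ℕ) :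
    Negligible fun n => if n < n₀ then 1 else 10 * (n : ℝ) ^ 2 * Real.exp (-Real.log n ^ 2) := by
  intro m
  have hlog : Tendsto (fun n : ℕ => Real.log n) atTop atTop :=
    Real.tendsto_log_atTop.comp tendsto_natCast_atTop_atTop
  have hlim : Tendsto (fun n : ℕ => 10 * Real.exp (-Real.log n)) atTop (𝓝 0) := by
    have := (Real.tendsto_exp_neg_atTop_nhds_zero.comp hlog).const_mul 10
    simpa using this
  refine squeeze_zero' (Eventually.of_forall fun n => ?_) ?_ hlim
  · beta_reduce
    split_ifs <;> positivity
  · filter_upwards [eventually_ge_atTop n₀, eventually_ge_atTop 1,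
      hlog.eventually_ge_atTop (m + 3 : ℝ)] with n hn hn1 hl
    have hn0 : (0 : ℝ) < n := by exact_mod_cast hn1
    rw [if_neg (not_lt.2 hn)]
    have e1 : (n : ℝ) ^ (m + 2) = Real.exp ((m + 2 : ℕ) * Real.log n) := by
      rw [Real.exp_nat_mul, Real.exp_log hn0]
    calc (n : ℝ) ^ m * (10 * (n : ℝ) ^ 2 * Real.exp (-Real.log n ^ 2))
        = 10 * ((n : ℝ) ^ (m + 2) * Real.exp (-Real.log n ^ 2)) := by ring
      _ = 10 * Real.exp ((m + 2 : ℕ) * Real.log n + -Real.log n ^ 2) := by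
        rw [e1, ← Real.exp_add]
      _ ≤ 10 * Real.exp (-Real.log n) := by
        gcongr
        push_cast
        have : (0 : ℝ) ≤ m := by positivity
        nlinarith

/-- The factor 2 makes the base at least 1 already at `n = 2`. -/
theorem isThetaTilde_div_log_pow (g : ℕ → ℕ → ℝ) (hg : ∀ n d, 0 ≤ g n d) (b : ℕ) :
    IsThetaTilde (fun n d => g n d / (2 * Real.log n) ^ b) g := by
  refine ⟨2 ^ b, by positivity, b, fun n d hn _ => ⟨by beta_reduce; rw [mul_pow], ?_⟩⟩
  have hlog : 1 ≤ 2 * Real.log n := by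
    have h1 : Real.log 2 ≤ Real.log n :=
      Real.log_le_log (by norm_num) (by exact_mod_cast hn)
    linarith [Real.log_two_gt_d9]
  have h1 : 1 ≤ (2 * Real.log n) ^ b := one_le_pow₀ hlog
  rw [← mul_pow]
  calc g n d / (2 * Real.log n) ^ b ≤ g n d := div_le_self (hg n d) h1
    _ ≤ _ := le_mul_of_one_le_left (hg n d) h1

end RobustOLS

/-! ### Assembly with `l = log n`, `t = l ^ α` and `q = exp (-l ^ 2)`. -/

theorem mainTheorem2 (C c t₀ : ℝ) (hC : 0 < C) (hc : 0 < c) (ht₀ : 0 < t₀) :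
    ∃ (kThreshold : ℕ → ℕ → ℝ) (K : ℝ) (a : ℕ) (η : ℕ → ℝ),
      RobustOLS.IsThetaTilde kThreshold
        (fun n d => min ((n : ℝ) / √(d : ℝ)) ((n : ℝ) ^ 2 / (d : ℝ) ^ 2)) ∧
      0 < K ∧
      RobustOLS.Negligible η ∧
      ∀ (n d : ℕ) (μ : Measure (Fin d → ℝ)), RobustOLS.WellBehaved C c t₀ μ →
        ∀ (βgt e : Fin d → ℝ), e ⬝ᵥ e = 1 →
          RobustOLS.designNoiseLaw μ n
            {p | ¬ ∀ k : ℕ, 1 ≤ k → k ≤ n → (k : ℝ) < kThreshold n d →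
              let X : Matrix (Fin n) (Fin d) ℝ := Matrix.of p.1
              let Y : Fin n → ℝ := X *ᵥ βgt + p.2
              let U : ℝ := RobustOLS.acreUpper X Y e k
              let L : ℝ := RobustOLS.acreLower X Y e k
              0 < L ∧ 1 ≤ U / L ∧
                U / L ≤ 1 + K * Real.log n ^ a * (((d : ℝ) + k * √(d : ℝ)) / n)} ≤
            ENNReal.ofReal (η n) := by
  obtain ⟨p₁, hp₁, hball⟩ := RobustOLS.exists_small_ball t₀ hC hc
  obtain ⟨p₂, hp₂, hgauss⟩ := RobustOLS.exists_gaussian_tail_lower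
  set p := min p₁ p₂
  have hp : 0 < p := lt_min hp₁ hp₂
  set α : ℕ := max 2 ⌈3 / C⌉₊
  have hα2 : 2 ≤ α := le_max_left _ _
  have hαC : 3 ≤ α * C := by
    rw [← div_le_iff₀ hC]
    exact (Nat.le_ceil _).trans (Nat.cast_le.2 (le_max_right _ _))
  have hlog : Tendsto (fun n : ℕ => Real.log n) atTop atTop :=
    Real.tendsto_log_atTop.comp tendsto_natCast_atTop_atTop
  have hpow : ∀ᶠ n : ℕ in atTop, Real.log n ^ (4 * α + 5) ≤ n := by
    have h := (Real.isLittleO_pow_log_id_atTop (n := 4 * α + 5)).comp_tendsto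
      (tendsto_natCast_atTop_atTop (R := ℝ))
    filter_upwards [h.bound one_pos] with n hn
    simp only [Function.comp_apply, id, one_mul] at hn
    exact (le_abs_self _).trans (hn.trans_eq (by simp))
  obtain ⟨n₀, hn₀⟩ := eventually_atTop.1 (hpow.and ((hlog.eventually_ge_atTop
    (128 + 512 / p + t₀ + 1 / c)).and (eventually_ge_atTop 3)))
  refine ⟨fun n d => min ((n : ℝ) / √(d : ℝ)) ((n : ℝ) ^ 2 / (d : ℝ) ^ 2) /
      (2 * Real.log n) ^ (2 * (8 * α + 5)), 128, 5 * α + 2,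
    -- The value 1 makes the claim trivial for small `n` and does not affect negligibility.
    fun n => if n < n₀ then 1 else 10 * (n : ℝ) ^ 2 * Real.exp (-Real.log n ^ 2),
    RobustOLS.isThetaTilde_div_log_pow _ (fun n d => by positivity) _, by norm_num,
    RobustOLS.negligible_exp_log_sq n₀, ?_⟩
  intro n d μ hμ β e he
  have := hμ.isProbability
  have : IsProbabilityMeasure (RobustOLS.designNoiseLaw μ n) := by
    unfold RobustOLS.designNoiseLaw; infer_instance
  rcases lt_or_ge n n₀ with hn | hn
  · simpa [hn] using prob_le_one
  obtain ⟨hln, hl, hn3⟩ := hn₀ n hn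
  simp only [not_lt.2 hn, if_false]
  set l := Real.log n with hldef
  have hp512 : 0 < 512 / p := by positivity
  have hc1 : 0 < 1 / c := by positivity
  have hl128 : 128 ≤ l := by linarith
  have hl1 : 1 ≤ l := by linarith
  have hpl : 512 ≤ p * l := by
    rw [mul_comm, ← div_le_iff₀ hp]; linarith
  have hcl : 1 ≤ c * l := by
    rw [mul_comm, ← div_le_iff₀ hc]; linarith
  have hd : 1 ≤ d := by
    rcases Nat.eq_zero_or_pos d with rfl | h
    · simp at he
    · exact h
  -- Without an admissible `k` there is nothing to prove. A single one, `k₀`, yields the bounds on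
  -- `d` that the good event needs for all `k` at once.
  by_cases hex : ∃ k : ℕ, 1 ≤ k ∧
      (k : ℝ) < min ((n : ℝ) / √(d : ℝ)) ((n : ℝ) ^ 2 / (d : ℝ) ^ 2) / (2 * l) ^ (2 * (8 * α + 5))
  swap
  · push Not at hex
    refine le_trans (measure_mono (t := ∅) ?_) (by simp)
    exact fun ω hω => hω fun k hk _ hlt => absurd hlt (not_lt.2 (hex k hk))
  obtain ⟨k₀, hk₀, hlt₀⟩ := hex
  obtain ⟨f1, f2, f3⟩ := RobustOLS.threshold_facts hd hl1 hk₀ hlt₀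
  obtain ⟨-, -, -, -, hd1⟩ := RobustOLS.side_conditions hd hl128 f1 f2 f3
  have hmono : ∀ {a b : ℕ}, a ≤ b → l ^ a ≤ l ^ b := fun h => pow_le_pow_right₀ hl1 h
  have hl0 : 0 < l := by linarith
  have hn1 : 1 ≤ n := by omega
  have hn1' : (1 : ℝ) ≤ n := by exact_mod_cast hn1
  have hlN : l ≤ n := by
    have := hmono (show 1 ≤ 4 * α + 5 by omega)
    rw [pow_one] at this
    linarith
  have hl3N : l ^ 3 ≤ n := (hmono (by omega)).trans hln
  have hdl : ∀ {a : ℕ}, a ≤ 8 * α + 5 → d * l ^ a ≤ n := fun h =>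
    (mul_le_mul_of_nonneg_left (hmono h) (by positivity)).trans f3
  have hdn : (d : ℝ) ≤ n := by simpa using hdl (Nat.zero_le _)
  have ht₀l : t₀ ≤ l ^ α := by
    have := hmono (show 1 ≤ α by omega)
    rw [pow_one] at this
    linarith
  have main := hμ.acre (n := n) (t := l ^ α) (l := l) (q := Real.exp (-l ^ 2)) hp
    (fun hν v hv => (min_le_left _ _).trans (hball hν v hv))
    (fun θ z hθ hz => (min_le_right _ _).trans (hgauss θ z hθ hz))
    ht₀l (one_le_pow₀ hl1) hl1 hn1 (by exact_mod_cast hdn) β he hpl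
    (by nlinarith)
    (by
      have h1 : d * l ^ (α + 1) ≤ n := hdl (by omega)
      have h2 : 8 * d * l ^ α ≤ d * l ^ (α + 1) := by
        rw [pow_succ]
        have : (0 : ℝ) ≤ d * l ^ α := by positivity
        nlinarith
      nlinarith)
    hd1 (RobustOLS.exp_tail_le hαC hl1 hcl hc) (RobustOLS.exp_gaussian_le hα2 (by linarith))
    (RobustOLS.exp_net_le hn3 hldef hl1 (by linarith) (hdl (by omega)) (by
      calc 8 * l ^ 2 ≤ p * l * l ^ 2 := by gcongr; linarith
        _ = p * l ^ 3 := by ring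
        _ ≤ p * n := by gcongr))
    (RobustOLS.exp_count_le hl1 (by linarith) hln)
  refine le_trans (measure_mono ?_) main
  intro ω hω hgood
  refine hω fun k hk _ hlt => ?_
  obtain ⟨g1, g2, g3⟩ := RobustOLS.threshold_facts hd hl1 hk hlt
  obtain ⟨h1, h2, h3, h4, -⟩ := RobustOLS.side_conditions hd hl128 g1 g2 g3
  have := hgood k hk h1 h2 h3 h4
  refine ⟨this.1, this.2.1, this.2.2.trans_eq ?_⟩
  ring
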